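/- Let $P\subset\mathbb R^n$ be a Delzant polytope, i.e. a convex polytope such that the tangent cone of $P$ at every vertex is generated by a basis of the lattice $\mathbb Z^n$ (the vertices need not be lattice points), and let $\mathcal F(P)$ be the set of its nonempty faces, including $P$ itself. Let $X_P$ be the smooth projective toric variety of the normal fan of $P$, and for $f\in\mathcal F(P)$ let $Y_f\subseteq X_P$ be the toric subvariety corresponding to $f$. Explicitly: $\mathcal F(P)$ is finite, and there is a lattice polytope $Q$ with the same normal fan as $P$ (if $P$ is a lattice polytope, one may take $Q=P$). For any such $Q$ and $f\in\mathcal F(P)$ let $f_Q$ be the face of $Q$ with the same normal cone as $f$. In the projective space with homogeneous coordinates indexed by $Q\cap\mathbb Z^n$, $Y_f$ is the Zariski closure of the torus orbit consisting of the points with coordinates $t^m$ for $m\in f_Q\cap\mathbb Z^n$ and $0$ for the other $m\in Q\cap\mathbb Z^n$, where $t\in(\mathbb C^*)^n$; and $X_P=Y_P$. Let $K_0(\mathcal V_{\mathbb C})$ be the Grothendieck ring of complex quasi-projective varieties: it is generated by the isomorphism classes $[X]$, modulo the relations $[X]=[Y]+[X\setminus Y]$ for $Y\subseteq X$ such that $Y$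 and $X\setminus Y$ are Zariski locally closed, with product $[X]\cdot[Y]=[X\times Y]$ and with unit the class of a point. Then in $K_0(\mathcal V_{\mathbb C})$ $$\sum_{f\in\mathcal F(P)}(-1)^{\operatorname{codim} f}\,[Y_f]=[(\mathbb C^*)^n],$$ where $\operatorname{codim} f=n-\dim f$. In other words, the motivic interior $[X_P^\circ]:=\sum_{f}(-1)^{\operatorname{codim} f}[Y_f]$ of $X_P$ is the class of the torus. -/

import Mathlib

/-!
Complex quasi-projective varieties, their Grothendieck ring, and the projective toric variety
of a Delzant polytope.
-/

open scoped LinearAlgebra.Projectivization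

noncomputable section

/-! ### Projective space and its Zariski topology -/

/-- The complex projective space with homogeneous coordinates indexed by `ι`. -/
def ProjSpace (ι : Type) : Type := ℙ ℂ (ι → ℂ)

namespace ProjSpace

/-- A vector of homogeneous coordinates of a point. -/
def rep {ι : Type} (p : ProjSpace ι) : ι → ℂ := Projectivization.rep p

/-- `p.HasCoords v`: the vector `v` is a vector of homogeneous coordinates of `p`. -/
def HasCoords {ι : Type} (p : ProjSpace ι) (v : ι → ℂ) : Prop :=
  ∃ h : v ≠ 0, p = Projectivization.mk ℂ v h

/-- The set of points at which a polynomial does not vanish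
(used for homogeneous polynomials only, for which the choice of coordinates is irrelevant). -/
def basicOpen {ι : Type} (F : MvPolynomial ι ℂ) : Set (ProjSpace ι) :=
  {p | MvPolynomial.eval p.rep F ≠ 0}

/-- The Zariski topology: the non-vanishing sets of homogeneous polynomials are a basis. -/
instance zariskiTopology (ι : Type) : TopologicalSpace (ProjSpace ι) :=
  TopologicalSpace.generateFrom
    {U | ∃ (d : ℕ) (F : MvPolynomial ι ℂ), F.IsHomogeneous d ∧ U = basicOpen F}

theorem isOpen_basicOpen {ι : Type} {d : ℕ} {F : MvPolynomial ι ℂ} (hF : F.IsHomogeneous d) :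
    IsOpen (basicOpen F) :=
  TopologicalSpace.isOpen_generateFrom_of_mem ⟨d, F, hF, rfl⟩

theorem hasCoords_rep {ι : Type} (p : ProjSpace ι) : p.HasCoords p.rep :=
  ⟨Projectivization.rep_nonzero p, (Projectivization.mk_rep p).symm⟩

theorem HasCoords.exists_smul {ι : Type} {p : ProjSpace ι} {v w : ι → ℂ} (hv : p.HasCoords v)
    (hw : p.HasCoords w) : ∃ a : ℂ, a ≠ 0 ∧ v = a • w := by
  obtain ⟨hv0, hv⟩ := hv
  obtain ⟨hw0, hw⟩ := hw
  rw [hv] at hw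
  obtain ⟨a, ha⟩ := (Projectivization.mk_eq_mk_iff ℂ v w hv0 hw0).1 hw
  exact ⟨a, a.ne_zero, ha.symm⟩

theorem HasCoords.smul {ι : Type} {p : ProjSpace ι} {v : ι → ℂ} (hv : p.HasCoords v)
    {a : ℂ} (ha : a ≠ 0) : p.HasCoords (a • v) := by
  obtain ⟨hv0, hv⟩ := hv
  refine ⟨smul_ne_zero ha hv0, ?_⟩
  rw [hv]
  exact (Projectivization.mk_eq_mk_iff' ℂ _ _ _ _).2
    ⟨a⁻¹, by rw [smul_smul, inv_mul_cancel₀ ha, one_smul]⟩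

theorem HasCoords.unique {ι : Type} {p q : ProjSpace ι} {v : ι → ℂ} (hp : p.HasCoords v)
    (hq : q.HasCoords v) : p = q := by
  obtain ⟨_, hp⟩ := hp
  obtain ⟨_, hq⟩ := hq
  rw [hp, hq]

theorem exists_hasCoords {ι : Type} {v : ι → ℂ} (hv : v ≠ 0) : ∃ p : ProjSpace ι, p.HasCoords v :=
  ⟨Projectivization.mk ℂ v hv, hv, rfl⟩

theorem eval_smul {ι : Type} {d : ℕ} {F : MvPolynomial ι ℂ} (hF : F.IsHomogeneous d) (a : ℂ)
    (v : ι → ℂ) : MvPolynomial.eval (a • v) F = a ^ d * MvPolynomial.eval v F := by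
  rw [MvPolynomial.eval_eq, MvPolynomial.eval_eq, Finset.mul_sum]
  refine Finset.sum_congr rfl fun s hs => ?_
  have h : ∑ i ∈ s.support, s i = d := by
    have := hF (MvPolynomial.mem_support_iff.1 hs)
    simpa [Finsupp.weight_apply, Finsupp.sum] using this
  simp only [Pi.smul_apply, smul_eq_mul, mul_pow, Finset.prod_mul_distrib]
  rw [Finset.prod_pow_eq_pow_sum, h]
  ring

/-- For a homogeneous polynomial, vanishing at a point does not depend on the coordinates. -/
theorem HasCoords.mem_basicOpen {ι : Type} {p : ProjSpace ι} {v : ι → ℂ} (hv : p.HasCoords v)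
    {d : ℕ} {F : MvPolynomial ι ℂ} (hF : F.IsHomogeneous d) :
    p ∈ basicOpen F ↔ MvPolynomial.eval v F ≠ 0 := by
  obtain ⟨a, ha, h⟩ := hv.exists_smul p.hasCoords_rep
  rw [h, eval_smul hF]
  simp [basicOpen, ha]

end ProjSpace

/-! ### Products: the Segre embedding -/

/-- The image of `X × Y` under the Segre embedding `([x], [y]) ↦ [x i * y j]`. -/
def segre {ι κ : Type} (X : Set (ProjSpace ι)) (Y : Set (ProjSpace κ)) :
    Set (ProjSpace (ι × κ)) :=
  {z | ∃ x ∈ X, ∃ y ∈ Y, z.HasCoords fun ij => x.rep ij.1 * y.rep ij.2}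

theorem isClosed_segre_univ (ι κ : Type) :
    IsClosed (segre (Set.univ : Set (ProjSpace ι)) (Set.univ : Set (ProjSpace κ))) := by
  let F : ι → ι → κ → κ → MvPolynomial (ι × κ) ℂ := fun i k j l =>
    MvPolynomial.X (i, j) * MvPolynomial.X (k, l) - MvPolynomial.X (i, l) * MvPolynomial.X (k, j)
  have hF : ∀ i k j l, (F i k j l).IsHomogeneous 2 := fun i k j l =>
    ((MvPolynomial.isHomogeneous_X ℂ _).mul (MvPolynomial.isHomogeneous_X ℂ _)).sub
      ((MvPolynomial.isHomogeneous_X ℂ _).mul (MvPolynomial.isHomogeneous_X ℂ _))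
  have : (segre (Set.univ : Set (ProjSpace ι)) (Set.univ : Set (ProjSpace κ)))ᶜ =
      ⋃ i, ⋃ k, ⋃ j, ⋃ l, ProjSpace.basicOpen (F i k j l) := by
    ext z
    simp only [Set.mem_compl_iff, Set.mem_iUnion]
    rw [not_iff_comm]
    constructor
    · intro h
      have hz : ∀ i k j l, z.rep (i, j) * z.rep (k, l) = z.rep (i, l) * z.rep (k, j) := by
        intro i k j l
        by_contra hne
        refine h ⟨i, k, j, l, ?_⟩
        simpa [ProjSpace.basicOpen, F, sub_eq_zero] using hne
      obtain ⟨⟨i0, j0⟩, h0⟩ := Function.ne_iff.1 (z.hasCoords_rep).1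
      have h0' : z.rep (i0, j0) ≠ 0 := h0
      obtain ⟨x, hx⟩ := ProjSpace.exists_hasCoords (v := fun i => z.rep (i, j0))
        (Function.ne_iff.2 ⟨i0, h0'⟩)
      obtain ⟨y, hy⟩ := ProjSpace.exists_hasCoords (v := fun j => z.rep (i0, j))
        (Function.ne_iff.2 ⟨j0, h0'⟩)
      obtain ⟨a, ha, hxa⟩ := x.hasCoords_rep.exists_smul hx
      obtain ⟨b, hb, hyb⟩ := y.hasCoords_rep.exists_smul hy
      refine ⟨x, trivial, y, trivial, ?_⟩
      have := z.hasCoords_rep.smul (mul_ne_zero (mul_ne_zero ha hb) h0')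
      convert this using 1
      ext ⟨i, j⟩
      simp only [hxa, hyb, Pi.smul_apply, smul_eq_mul]
      linear_combination a * b * (hz i i0 j0 j)
    · rintro ⟨x, -, y, -, h⟩ ⟨i, k, j, l, hz⟩
      rw [h.mem_basicOpen (hF i k j l)] at hz
      apply hz
      simp only [F, map_sub, map_mul, MvPolynomial.eval_X]
      ring
  rw [← isOpen_compl_iff, this]
  exact isOpen_iUnion fun i => isOpen_iUnion fun k => isOpen_iUnion fun j => isOpen_iUnion fun l =>
    ProjSpace.isOpen_basicOpen (hF i k j l)

/-- A map from a projective set given by columns or rows of the coordinates is continuous. -/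
theorem continuous_of_slices {ι κ ρ : Type} {S : Set (ProjSpace ρ)} (g : κ → ι → ρ)
    (hg : ∀ r, ∃ j i, g j i = r)
    (f : S → ProjSpace ι) (hf : ∀ z : S, ∃ c : κ → ℂ, ∀ j i, z.1.rep (g j i) = (f z).rep i * c j) :
    Continuous f := by
  refine continuous_generateFrom_iff.2 ?_
  rintro _ ⟨d, F, hF, rfl⟩
  let G : κ → ι → MvPolynomial ρ ℂ := fun j i =>
    MvPolynomial.X (g j i) * MvPolynomial.aeval (fun i' => MvPolynomial.X (g j i')) F
  have hG : ∀ j i, (G j i).IsHomogeneous (1 + 1 * d) := fun j i =>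
    (MvPolynomial.isHomogeneous_X ℂ _).mul
      (hF.aeval _ (fun _ => MvPolynomial.isHomogeneous_X ℂ _))
  have hev : ∀ (z : S) (c : κ → ℂ), (∀ j i, z.1.rep (g j i) = (f z).rep i * c j) → ∀ j i,
      MvPolynomial.eval z.1.rep (G j i) =
        (f z).rep i * c j * ((c j) ^ d * MvPolynomial.eval (f z).rep F) := by
    intro z c hc j i
    rw [← ProjSpace.eval_smul hF, ← hc j i]
    simp only [G, map_mul, MvPolynomial.eval_X]
    congr 1
    have h1 : (c j • (f z).rep) = fun i' => z.1.rep (g j i') := by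
      ext i'
      simp [hc, mul_comm]
    rw [h1, MvPolynomial.aeval_def, MvPolynomial.eval₂_eq, map_sum, MvPolynomial.eval_eq]
    simp
  have : f ⁻¹' ProjSpace.basicOpen F =
      Subtype.val ⁻¹' (⋃ j, ⋃ i, ProjSpace.basicOpen (G j i)) := by
    ext z
    obtain ⟨c, hc⟩ := hf z
    simp only [Set.mem_preimage, Set.mem_iUnion, ProjSpace.basicOpen, Set.mem_ofPred_eq]
    constructor
    · intro h
      obtain ⟨r, hr⟩ := Function.ne_iff.1 (z.1.hasCoords_rep).1
      obtain ⟨j, i, rfl⟩ := hg r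
      have hr' : z.1.rep (g j i) ≠ 0 := hr
      refine ⟨j, i, ?_⟩
      rw [hev z c hc]
      rw [hc] at hr'
      exact mul_ne_zero hr' (mul_ne_zero (pow_ne_zero _ (right_ne_zero_of_mul hr')) h)
    · rintro ⟨j, i, h⟩
      rw [hev z c hc] at h
      exact right_ne_zero_of_mul (right_ne_zero_of_mul h)
  rw [this]
  exact (isOpen_iUnion fun j => isOpen_iUnion fun i =>
    ProjSpace.isOpen_basicOpen (hG j i)).preimage continuous_subtype_val

theorem isLocallyClosed_segre {ι κ : Type} {X : Set (ProjSpace ι)} {Y : Set (ProjSpace κ)}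
    (hX : IsLocallyClosed X) (hY : IsLocallyClosed Y) : IsLocallyClosed (segre X Y) := by
  let S : Set (ProjSpace (ι × κ)) := segre Set.univ Set.univ
  have hS : ∀ z : S, ∃ (x : ProjSpace ι) (y : ProjSpace κ) (c : ℂ), c ≠ 0 ∧
      ∀ i j, z.1.rep (i, j) = c * (x.rep i * y.rep j) := by
    rintro ⟨z, x, -, y, -, h⟩
    obtain ⟨c, hc, h⟩ := z.hasCoords_rep.exists_smul h
    exact ⟨x, y, c, hc, fun i j => by rw [h]; rfl⟩
  choose x y c hc h using hS
  have hcoord : ∀ z : S, z.1.HasCoords fun ij => (x z).rep ij.1 * (y z).rep ij.2 := by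
    intro z
    have := z.1.hasCoords_rep.smul (inv_ne_zero (hc z))
    convert this using 1
    ext ⟨i, j⟩
    simp [h, hc]
  have hxc : Continuous x := continuous_of_slices (fun (j : κ) (i : ι) => (i, j))
    (fun r => ⟨r.2, r.1, rfl⟩) x fun z => ⟨fun j => c z * (y z).rep j, fun j i => by rw [h]; ring⟩
  have hyc : Continuous y := continuous_of_slices (fun (i : ι) (j : κ) => (i, j))
    (fun r => ⟨r.1, r.2, rfl⟩) y fun z => ⟨fun i => c z * (x z).rep i, fun i j => by rw [h]; ring⟩
  have himage : segre X Y = Subtype.val '' (x ⁻¹' X ∩ y ⁻¹' Y) := by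
    ext z
    constructor
    · rintro ⟨x', hx', y', hy', hz⟩
      let w : S := ⟨z, x', trivial, y', trivial, hz⟩
      obtain ⟨a, ha, hw⟩ := (hcoord w).exists_smul hz
      have hw' : ∀ i j, (x w).rep i * (y w).rep j = a * (x'.rep i * y'.rep j) := fun i j =>
        congrFun hw (i, j)
      obtain ⟨i0, hi0⟩ := Function.ne_iff.1 (x w).hasCoords_rep.1
      obtain ⟨j0, hj0⟩ := Function.ne_iff.1 (y w).hasCoords_rep.1
      have hi0' : (x w).rep i0 ≠ 0 := hi0
      have hj0' : (y w).rep j0 ≠ 0 := hj0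
      have hne : a * (x'.rep i0 * y'.rep j0) ≠ 0 := by
        rw [← hw']; exact mul_ne_zero hi0' hj0'
      have hx0 : x'.rep i0 ≠ 0 := left_ne_zero_of_mul (right_ne_zero_of_mul hne)
      have hy0 : y'.rep j0 ≠ 0 := right_ne_zero_of_mul (right_ne_zero_of_mul hne)
      have hxe : x w = x' := by
        refine ProjSpace.HasCoords.unique ((x w).hasCoords_rep.smul hj0') ?_
        have := x'.hasCoords_rep.smul (mul_ne_zero ha hy0)
        convert this using 1
        ext i
        simp only [Pi.smul_apply, smul_eq_mul]
        linear_combination hw' i j0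
      have hye : y w = y' := by
        refine ProjSpace.HasCoords.unique ((y w).hasCoords_rep.smul hi0') ?_
        have := y'.hasCoords_rep.smul (mul_ne_zero ha hx0)
        convert this using 1
        ext j
        simp only [Pi.smul_apply, smul_eq_mul]
        linear_combination hw' i0 j
      exact ⟨w, ⟨by rw [Set.mem_preimage, hxe]; exact hx', by rw [Set.mem_preimage, hye]; exact hy'⟩,
        rfl⟩
    · rintro ⟨w, ⟨hxw, hyw⟩, rfl⟩
      exact ⟨x w, hxw, y w, hyw, hcoord w⟩
  rw [himage]
  refine IsLocallyClosed.image ((hX.preimage hxc).inter (hY.preimage hyc))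
    Topology.IsInducing.subtypeVal ?_
  rw [Subtype.range_coe]
  exact (isClosed_segre_univ ι κ).isLocallyClosed

/-! ### Quasi-projective varieties and their Grothendieck ring -/

/-- A complex quasi-projective variety: a Zariski locally closed subset of a finite-dimensional
complex projective space (not necessarily irreducible, possibly empty). -/
structure QPVariety where
  /-- The index set of the homogeneous coordinates of the ambient projective space. -/
  index : Type
  [finite_index : Finite index]
  /-- The set of points. -/
  carrier : Set (ProjSpace index)
  isLocallyClosed : IsLocallyClosed carrier

namespace QPVariety

attribute [instance] QPVariety.finite_index

/-- A map of quasi-projective varieties is regular if it is given, in a Zariski neighbourhood of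
every point, by homogeneous polynomials of the same degree without common zero there. -/
def IsRegular (X Y : QPVariety) (f : X.carrier → Y.carrier) : Prop :=
  ∀ x : X.carrier, ∃ U : Set (ProjSpace X.index), IsOpen U ∧ x.1 ∈ U ∧
    ∃ (d : ℕ) (F : Y.index → MvPolynomial X.index ℂ), (∀ k, (F k).IsHomogeneous d) ∧
      ∀ x' : X.carrier, x'.1 ∈ U →
        (f x').1.HasCoords fun k => MvPolynomial.eval x'.1.rep (F k)

/-- Isomorphism of quasi-projective varieties: a bijection, regular in both directions. -/
def Isomorphic (X Y : QPVariety) : Prop :=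
  ∃ e : X.carrier ≃ Y.carrier, IsRegular X Y e ∧ IsRegular Y X e.symm

/-- The subvariety of `X` on a subset that is Zariski locally closed. -/
def restrict (X : QPVariety) (Y : Set (ProjSpace X.index)) (hY : IsLocallyClosed Y) :
    QPVariety where
  index := X.index
  carrier := Y
  isLocallyClosed := hY

/-- The product of two quasi-projective varieties, embedded by the Segre map. -/
def prod (X Y : QPVariety) : QPVariety where
  index := X.index × Y.index
  carrier := segre X.carrier Y.carrier
  isLocallyClosed := isLocallyClosed_segre X.isLocallyClosed Y.isLocallyClosed

/-- The point, as the projective space with one homogeneous coordinate. -/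
def point : QPVariety where
  index := Unit
  carrier := Set.univ
  isLocallyClosed := isOpen_univ.isLocallyClosed

/-- The algebraic torus `(ℂ*)ⁿ`, as the set of the points of the `n`-dimensional projective space
all of whose `n + 1` homogeneous coordinates are nonzero. -/
def torus (n : ℕ) : QPVariety where
  index := Fin (n + 1)
  carrier := {p | ∀ i, p.rep i ≠ 0}
  isLocallyClosed := by
    have h : {p : ProjSpace (Fin (n + 1)) | ∀ i, p.rep i ≠ 0} =
        ⋂ i, ProjSpace.basicOpen (MvPolynomial.X i) := by
      ext p
      simp [ProjSpace.basicOpen]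
    rw [h]
    exact (isOpen_iInter_of_finite fun i =>
      ProjSpace.isOpen_basicOpen (MvPolynomial.isHomogeneous_X ℂ i)).isLocallyClosed

end QPVariety

/-- The defining relations of the Grothendieck ring of complex quasi-projective varieties, in the
free commutative ring on all quasi-projective varieties. -/
inductive K0Rel : FreeCommRing QPVariety → FreeCommRing QPVariety → Prop
  | iso (X Y : QPVariety) (h : X.Isomorphic Y) : K0Rel (.of X) (.of Y)
  | scissors (X : QPVariety) (Y : Set (ProjSpace X.index)) (hYX : Y ⊆ X.carrier)
      (hY : IsLocallyClosed Y) (hXY : IsLocallyClosed (X.carrier \ Y)) :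
      K0Rel (.of X) (.of (X.restrict Y hY) + .of (X.restrict (X.carrier \ Y) hXY))
  | mul (X Y : QPVariety) : K0Rel (.of X * .of Y) (.of (X.prod Y))
  | one : K0Rel (.of QPVariety.point) 1

/-- The Grothendieck ring of complex quasi-projective varieties. -/
abbrev K0 : Type 1 := RingQuot K0Rel

/-- The class `[X]` in the Grothendieck ring. -/
def QPVariety.toK0 (X : QPVariety) : K0 := RingQuot.mkRingHom K0Rel (.of X)

/-! ### Polytopes and normal fans -/

/-- The inclusion of the lattice `ℤⁿ` in `ℝⁿ`. -/
def latticeToReal {n : ℕ} (m : Fin n → ℤ) : Fin n → ℝ := fun i => (m i : ℝ)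

/-- The set of the nonempty faces of a polytope (the polytope itself included). -/
def faces {n : ℕ} (P : Set (Fin n → ℝ)) : Set (Set (Fin n → ℝ)) :=
  {f | f.Nonempty ∧ IsExposed ℝ P f}

/-- The dimension of (the affine hull of) a set. -/
def faceDim {n : ℕ} (f : Set (Fin n → ℝ)) : ℕ := Module.finrank ℝ (vectorSpan ℝ f)

/-- The (inner) normal cone of `P` along `f`: the linear forms whose minimum on `P` is attained
at all points of `f`. -/
def normalCone {n : ℕ} (P f : Set (Fin n → ℝ)) : Set (StrongDual ℝ (Fin n → ℝ)) :=
  {u | ∀ x ∈ f, ∀ y ∈ P, u x ≤ u y}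

/-- The normal fan of a polytope: the set of the normal cones of its faces. -/
def normalFan {n : ℕ} (P : Set (Fin n → ℝ)) : Set (Set (StrongDual ℝ (Fin n → ℝ))) :=
  normalCone P '' faces P

/-- A Delzant polytope in `ℝⁿ`: a convex polytope such that the tangent cone at every vertex is
spanned by a basis of the lattice `ℤⁿ`. The vertices themselves need not be lattice points. -/
structure IsDelzant {n : ℕ} (P : Set (Fin n → ℝ)) : Prop where
  polytope : ∃ S : Finset (Fin n → ℝ), S.Nonempty ∧ P = convexHull ℝ (S : Set (Fin n → ℝ))
  smooth : ∀ v ∈ P.extremePoints ℝ, ∃ e : Module.Basis (Fin n) ℤ (Fin n → ℤ),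
    ∀ y : Fin n → ℝ, (∃ ε : ℝ, 0 < ε ∧ v + ε • y ∈ P) ↔
      ∃ c : Fin n → ℝ, (∀ i, 0 ≤ c i) ∧ y = ∑ i, c i • latticeToReal (e i)

/-- A lattice polytope: the convex hull of a nonempty finite set of lattice points. -/
structure LatticePolytope (n : ℕ) where
  /-- A finite set of lattice points whose convex hull is the polytope. -/
  generators : Finset (Fin n → ℤ)
  nonempty : generators.Nonempty

namespace LatticePolytope

/-- The polytope as a set. -/
def toSet {n : ℕ} (Q : LatticePolytope n) : Set (Fin n → ℝ) :=
  convexHull ℝ (latticeToReal '' (Q.generators : Set (Fin n → ℤ)))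

/-- The type of the lattice points of the polytope. -/
def LatticePoint {n : ℕ} (Q : LatticePolytope n) : Type :=
  {m : Fin n → ℤ // latticeToReal m ∈ Q.toSet}

instance {n : ℕ} (Q : LatticePolytope n) : Finite Q.LatticePoint := by
  have hb : Bornology.IsBounded Q.toSet :=
    isBounded_convexHull.2 ((Q.generators.finite_toSet.image _).isBounded)
  obtain ⟨r, hr⟩ := hb.exists_norm_le
  have hfin : {m : Fin n → ℤ | latticeToReal m ∈ Q.toSet}.Finite := by
    refine (Set.finite_Icc (fun _ => -⌈r⌉ : Fin n → ℤ) fun _ => ⌈r⌉).subset fun m hm => ?_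
    have h : ∀ i, |(m i : ℝ)| ≤ ⌈r⌉ := fun i =>
      ((norm_le_pi_norm (latticeToReal m) i).trans (hr _ hm)).trans (Int.le_ceil r)
    rw [Set.mem_Icc]
    refine ⟨fun i => ?_, fun i => ?_⟩
    · exact_mod_cast (abs_le.1 (h i)).1
    · exact_mod_cast (abs_le.1 (h i)).2
  exact hfin.to_subtype

/-- The face of `Q` on which all linear forms of the cone `σ` attain their minimum. If `σ` is a
cone of the normal fan, it is the face with normal cone `σ`. -/
def faceOfCone {n : ℕ} (Q : LatticePolytope n) (σ : Set (StrongDual ℝ (Fin n → ℝ))) :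
    Set (Fin n → ℝ) :=
  {x ∈ Q.toSet | ∀ u ∈ σ, ∀ y ∈ Q.toSet, u x ≤ u y}

open Classical in
/-- The vector with coordinates `tᵐ`, for the lattice points `m` of the face of the cone `σ`,
and `0`, for the other lattice points `m` of `Q`. -/
def orbitVector {n : ℕ} (Q : LatticePolytope n) (σ : Set (StrongDual ℝ (Fin n → ℝ)))
    (t : Fin n → ℂˣ) : Q.LatticePoint → ℂ :=
  fun m => if latticeToReal m.1 ∈ Q.faceOfCone σ then ((∏ i, t i ^ m.1 i : ℂˣ) : ℂ) else 0

/-- The orbit of the torus `(ℂ*)ⁿ` that corresponds to the cone `σ`, in the projective space with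
homogeneous coordinates indexed by the lattice points of `Q`. The torus acts there by
multiplication of the coordinate of index `m` with `tᵐ`, and the orbit is that of the point with
coordinates `1` on the face of the cone `σ` and `0` elsewhere. -/
def torusOrbit {n : ℕ} (Q : LatticePolytope n) (σ : Set (StrongDual ℝ (Fin n → ℝ))) :
    Set (ProjSpace Q.LatticePoint) :=
  {p | ∃ t : Fin n → ℂˣ, p.HasCoords (Q.orbitVector σ t)}

/-- The toric subvariety of the cone `σ`: the Zariski closure of its torus orbit. For the zero
cone it is the closure of the image of `t ↦ [tᵐ]`, the toric variety of `Q` itself. -/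
def toricSubvariety {n : ℕ} (Q : LatticePolytope n) (σ : Set (StrongDual ℝ (Fin n → ℝ))) :
    QPVariety where
  index := Q.LatticePoint
  carrier := closure (Q.torusOrbit σ)
  isLocallyClosed := isClosed_closure.isLocallyClosed

end LatticePolytope

end

/-!
The toric variety `X` of `Q` is the disjoint union of the torus orbits `O_g`, one for each face `g`,
and `Y_f` is the union of the `O_g` with `g ⊆ f`. Hence `[Y_f]` is the sum of the `[O_g]` with
`g ⊆ f`, and in the alternating sum the class `[O_g]` has the coefficient
`∑ (-1) ^ codim f` over the faces `f ⊇ g`. Since the polytope is simple, these faces correspond to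
the subsets of a set with `codim g` elements, so the coefficient vanishes unless `g` is the
whole polytope, and only the class of the big orbit, which is the torus, is left.

The orbits are recognised by the support of the homogeneous coordinates: the class of a locally
closed subset of projective space is the sum of the classes of its strata of fixed support
(`classOf_eq_sum_strata`), `Y_f` is the part of `X` with support on the face `f_Q`
(`LatticePolytope.mem_closure_torusOrbit_iff`), and the coefficients are computed in
`LatticePolytope.sum_faces_neg_one_pow`.

The description of `Y_f` rests on affine charts at the vertices. The points of the closure of an
orbit satisfy the binomial equations of the lattice points
(`LatticePolytope.prod_eq_of_mem_closure`).
Some multiple of any lattice point of `Q` is a sum of vertices, so by these equations each point has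
a nonzero coordinate at some vertex `w`
(`LatticePolytope.exists_extremePoint_of_mem_closure`), and is then determined by its coordinates
at `w` and at the neighbours `w + e i` (`LatticePolytope.hasCoords_chartVector`). Conversely,
torus orbits are dense in the coordinate subspaces of the charts
(`LatticePolytope.mem_closure_torusOrbit`). That `P` and `Q` have corners with the same lattice
basis `e` follows from the equality of the normal fans (`LatticePolytope.exists_isSmoothCorner`).

A lattice polytope with the normal fan of `P` exists, because the fan depends only on equations and
strict inequalities with integral coefficients between the vertices, so that the coordinates of the
vertices can be made rational and then integral (`IsDelzant.exists_latticePolytope`).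
-/

/-! ### Rational approximation of the identity of `ℝ` by `ℚ`-linear maps -/

open Filter Topology in
/-- A sequence of `ℚ`-linear maps `ℝ → ℚ` that converges pointwise to the identity. Applied to the
coefficients of a finite system of linear equations and strict inequalities over `ℚ`, it turns a
real solution into a rational one. -/
theorem exists_rat_linearMap_tendsto :
    ∃ φ : ℕ → ℝ →ₗ[ℚ] ℚ, ∀ x : ℝ, Tendsto (fun k => ((φ k x : ℚ) : ℝ)) atTop (𝓝 x) := by
  have hr : ∀ x : ℝ, ∃ r : ℕ → ℚ, Tendsto (fun k => ((r k : ℚ) : ℝ)) atTop (𝓝 x) := by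
    intro x
    obtain ⟨s, hs, hx⟩ := mem_closure_iff_seq_limit.1 (Rat.denseRange_cast (𝕜 := ℝ) x)
    choose r hr using hs
    exact ⟨r, by simpa only [hr] using hx⟩
  choose r hr using hr
  let b := Module.Basis.ofVectorSpace ℚ ℝ
  refine ⟨fun k => b.constr ℚ fun i => r (b i) k, fun x => ?_⟩
  have h1 : ∀ k, (((b.constr ℚ fun i => r (b i) k) x : ℚ) : ℝ) =
      ∑ i ∈ (b.repr x).support, ((b.repr x i : ℚ) : ℝ) * ((r (b i) k : ℚ) : ℝ) := by
    intro k
    simp [Module.Basis.constr_apply, Finsupp.sum]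
  have h2 : x = ∑ i ∈ (b.repr x).support, ((b.repr x i : ℚ) : ℝ) * b i := by
    conv_lhs => rw [← b.linearCombination_repr x]
    simp [Finsupp.linearCombination_apply, Finsupp.sum, Rat.smul_def]
  simp only [h1]
  conv => enter [3, 1]; rw [h2]
  exact tendsto_finsetSum _ fun i _ => (hr (b i)).const_mul _

/-- Finitely many rational numbers have a common denominator. -/
theorem exists_common_denominator {κ : Type*} (s : Finset κ) (q : κ → ℚ) :
    ∃ N : ℕ, 0 < N ∧ ∃ z : κ → ℤ, ∀ i ∈ s, (z i : ℚ) = N * q i := by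
  refine ⟨∏ i ∈ s, (q i).den, Finset.prod_pos fun i _ => (q i).den_pos,
    fun i => ((∏ i ∈ s, (q i).den : ℕ) * q i).num, fun i hi => ?_⟩
  obtain ⟨k, hk⟩ := Finset.dvd_prod_of_mem (fun i => (q i).den) hi
  have hk' : ((∏ i ∈ s, (q i).den : ℕ) : ℚ) * q i = ((k * (q i).num : ℤ) : ℚ) := by
    rw [hk]
    push_cast
    rw [mul_right_comm, mul_comm ((q i).den : ℚ), Rat.mul_den_eq_num, mul_comm]
  beta_reduce
  rw [hk', Rat.num_intCast]

theorem latticeToReal_injective {n : ℕ} : Function.Injective (latticeToReal (n := n)) :=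
  fun _ _ h => funext fun i => Int.cast_injective (congrFun h i)

/-- A lattice point in the convex hull of lattice points is, after multiplication with a positive
integer, a sum of these lattice points. -/
theorem exists_multiset_of_mem_convexHull {n : ℕ} (G : Finset (Fin n → ℤ)) (m : Fin n → ℤ)
    (hm : latticeToReal m ∈ convexHull ℝ (latticeToReal '' (G : Set (Fin n → ℤ)))) :
    ∃ s : Multiset (Fin n → ℤ), s ≠ 0 ∧ (∀ y ∈ s, y ∈ G) ∧ s.sum = s.card • m := by
  classical
  rw [← Finset.coe_image, Finset.mem_convexHull'] at hm
  obtain ⟨c, hc0, hc1, hcm⟩ := hm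
  rw [Finset.sum_image latticeToReal_injective.injOn] at hc1 hcm
  obtain ⟨φ, hφ⟩ := exists_rat_linearMap_tendsto
  -- Some `φ k` is positive at `1` and nonnegative at all the coefficients.
  have hev : ∀ᶠ k in Filter.atTop, 0 < φ k 1 ∧ ∀ y ∈ G, 0 ≤ φ k (c (latticeToReal y)) := by
    refine ((hφ 1).eventually (lt_mem_nhds one_pos)).mp ?_
    have : ∀ᶠ k in Filter.atTop, ∀ y ∈ G, 0 ≤ φ k (c (latticeToReal y)) := by
      rw [Filter.eventually_all_finset]
      intro y hy
      rcases (hc0 _ (Finset.mem_image_of_mem _ hy)).eq_or_lt with h | h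
      · exact Filter.Eventually.of_forall fun k => by rw [← h, map_zero]
      · exact ((hφ _).eventually (lt_mem_nhds h)).mono fun k hk => by exact_mod_cast hk.le
    filter_upwards [this] with k hk h1
    exact ⟨by exact_mod_cast h1, hk⟩
  obtain ⟨k, hk1, hk0⟩ := hev.exists
  obtain ⟨N, hN, z, hz⟩ := exists_common_denominator G fun y => φ k (c (latticeToReal y))
  have hNq : (0 : ℚ) < N := by exact_mod_cast hN
  have hz0 : ∀ y ∈ G, 0 ≤ z y := fun y hy => by
    have : (0 : ℚ) ≤ z y := by rw [hz y hy]; exact mul_nonneg hNq.le (hk0 y hy)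
    exact_mod_cast this
  have hzN : ∀ y ∈ G, (((z y).toNat : ℤ) : ℚ) = N * φ k (c (latticeToReal y)) := fun y hy => by
    rw [Int.toNat_of_nonneg (hz0 y hy), hz y hy]
  have hcard : ((∑ y ∈ G, (z y).toNat : ℕ) : ℚ) = N * φ k 1 := by
    rw [← hc1, map_sum, Finset.mul_sum]
    push_cast
    exact Finset.sum_congr rfl fun y hy => by exact_mod_cast hzN y hy
  have hs : (∑ y ∈ G, Multiset.replicate (z y).toNat y).card = ∑ y ∈ G, (z y).toNat := by
    simp
  refine ⟨∑ y ∈ G, Multiset.replicate (z y).toNat y, ?_, ?_, ?_⟩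
  · intro h0
    rw [h0, Multiset.card_zero] at hs
    rw [← hs, Nat.cast_zero] at hcard
    exact (mul_pos hNq hk1).ne hcard
  · intro y hy
    obtain ⟨y', hy', h⟩ := Multiset.mem_sum.1 hy
    rwa [Multiset.eq_of_mem_replicate h]
  · rw [hs, Multiset.sum_sum]
    simp only [Multiset.sum_replicate]
    ext j
    have hj := congrFun hcm j
    simp only [Finset.sum_apply, Pi.smul_apply, smul_eq_mul, nsmul_eq_mul] at hj ⊢
    have hj' : ∑ y ∈ G, φ k (c (latticeToReal y)) * y j = φ k 1 * m j := by
      have h1 : ∀ (x : ℝ) (a : ℤ), φ k (x * (a : ℝ)) = φ k x * a := fun x a => by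
        rw [mul_comm, ← zsmul_eq_mul, map_zsmul, zsmul_eq_mul, mul_comm]
      rw [← h1, one_mul, show ((m j : ℤ) : ℝ) = latticeToReal m j from rfl, ← hj, map_sum]
      exact Finset.sum_congr rfl fun y _ => (h1 _ _).symm
    have : ((∑ y ∈ G, ((z y).toNat : ℤ) * y j : ℤ) : ℚ) =
        ((∑ y ∈ G, (z y).toNat : ℕ) : ℚ) * m j := by
      rw [hcard, mul_assoc, ← hj', Finset.mul_sum]
      push_cast
      refine Finset.sum_congr rfl fun y hy => ?_
      have := hzN y hy
      push_cast at this
      rw [this, mul_assoc]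
    exact_mod_cast this

/-! ### Faces and normal fans of polytopes -/

/-- A linear form is at least `a` on a convex hull if it is so on the generators. -/
theorem le_of_mem_convexHull {E : Type*} [AddCommGroup E] [Module ℝ E] [TopologicalSpace E]
    {S : Set E} (u : StrongDual ℝ E) {a : ℝ} (h : ∀ y ∈ S, a ≤ u y) {x : E}
    (hx : x ∈ convexHull ℝ S) : a ≤ u x :=
  convexHull_min (t := {x | a ≤ u x}) h
    (convex_halfSpace_ge ⟨fun x y => map_add u x y, fun c x => map_smul u c x⟩ a) hx

/-- A nonempty face is the locus where some linear form attains its minimum. -/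
theorem mem_faces_iff {n : ℕ} {P f : Set (Fin n → ℝ)} :
    f ∈ faces P ↔ f.Nonempty ∧
      ∃ u : StrongDual ℝ (Fin n → ℝ), f = {x ∈ P | ∀ y ∈ P, u x ≤ u y} := by
  constructor
  · rintro ⟨hf, he⟩
    obtain ⟨l, hl⟩ := he hf
    exact ⟨hf, -l, by simpa using hl⟩
  · rintro ⟨hf, u, hu⟩
    exact ⟨hf, fun _ => ⟨-u, by simpa using hu⟩⟩

theorem face_eq_convexHull {n : ℕ} {S : Set (Fin n → ℝ)} (hS : S.Finite) {f : Set (Fin n → ℝ)}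
    (hf : IsExposed ℝ (convexHull ℝ S) f) : f = convexHull ℝ (f ∩ S) := by
  have hconv : Convex ℝ f := hf.convex (convex_convexHull ℝ S)
  refine Set.Subset.antisymm ?_ (convexHull_min Set.inter_subset_left hconv)
  have hcomp : IsCompact f := hf.isCompact (hS.isCompact_convexHull (𝕜 := ℝ))
  refine (closure_convexHull_extremePoints hcomp hconv).symm.subset.trans ?_
  have hsub : f.extremePoints ℝ ⊆ f ∩ S := fun x hx => ⟨hx.1, extremePoints_convexHull_subset
    (𝕜 := ℝ) (hf.isExtreme.extremePoints_subset_extremePoints hx)⟩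
  exact (closure_mono (convexHull_mono hsub)).trans
    ((hS.subset Set.inter_subset_right).isClosed_convexHull (𝕜 := ℝ)).closure_subset

theorem finite_faces {n : ℕ} {S : Set (Fin n → ℝ)} (hS : S.Finite) :
    (faces (convexHull ℝ S)).Finite := by
  refine (hS.finite_subsets.image (convexHull ℝ)).subset fun f hf => ?_
  exact ⟨f ∩ S, Set.inter_subset_right, (face_eq_convexHull hS hf.2).symm⟩

theorem convexHull_extremePoints_eq {n : ℕ} {S : Set (Fin n → ℝ)} (hS : S.Finite) :
    convexHull ℝ ((convexHull ℝ S).extremePoints ℝ) = convexHull ℝ S := by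
  have h := closure_convexHull_extremePoints (hS.isCompact_convexHull (𝕜 := ℝ))
    (convex_convexHull ℝ S)
  rwa [IsClosed.closure_eq] at h
  exact (hS.subset (extremePoints_convexHull_subset (𝕜 := ℝ))).isClosed_convexHull (𝕜 := ℝ)

/-- An extreme point of a polytope is the only minimum of some linear form. -/
theorem exists_forall_lt_of_extremePoint {n : ℕ} {S : Set (Fin n → ℝ)} (hS : S.Finite)
    {w : Fin n → ℝ} (hw : w ∈ (convexHull ℝ S).extremePoints ℝ) :
    ∃ u : StrongDual ℝ (Fin n → ℝ), ∀ s ∈ S, s ≠ w → u w < u s := by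
  have hw' : w ∉ convexHull ℝ (S \ {w}) := by
    intro h
    have h1 := (isExtreme_singleton.2 hw).convex_sdiff (convex_convexHull ℝ S)
    have h2 : convexHull ℝ (S \ {w}) ⊆ convexHull ℝ S \ {w} :=
      convexHull_min (Set.sdiff_subset_sdiff_left (subset_convexHull ℝ S)) h1
    exact (h2 h).2 rfl
  obtain ⟨u, a, h1, h2⟩ := geometric_hahn_banach_point_closed (convex_convexHull ℝ _)
    ((hS.subset Set.sdiff_subset).isClosed_convexHull (𝕜 := ℝ)) hw'
  exact ⟨u, fun s hs hsw => h1.trans (h2 s (subset_convexHull ℝ _ ⟨hs, hsw⟩))⟩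

/-- The normal cones of a polytope, in terms of the sets of the generators at which linear forms
attain their minimum. -/
theorem normalFan_convexHull {n : ℕ} {ι : Type*} {V : Set ι} (hV : V.Finite) (hne : V.Nonempty)
    (a : ι → Fin n → ℝ) :
    normalFan (convexHull ℝ (a '' V)) = Set.range fun u : StrongDual ℝ (Fin n → ℝ) =>
      {u' : StrongDual ℝ (Fin n → ℝ) | ∀ i ∈ V, (∀ j ∈ V, u (a i) ≤ u (a j)) →
        ∀ j ∈ V, u' (a i) ≤ u' (a j)} := by
  have hfin : (a '' V).Finite := hV.image a
  have hmin : ∀ (u : StrongDual ℝ (Fin n → ℝ)) (x : Fin n → ℝ),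
      (∀ y ∈ convexHull ℝ (a '' V), u x ≤ u y) ↔ ∀ j ∈ V, u x ≤ u (a j) := fun u x =>
    ⟨fun h j hj => h _ (subset_convexHull ℝ _ ⟨j, hj, rfl⟩), fun h y hy =>
      le_of_mem_convexHull u (by rintro _ ⟨j, hj, rfl⟩; exact h j hj) hy⟩
  have key : ∀ (u : StrongDual ℝ (Fin n → ℝ)) (f : Set (Fin n → ℝ)),
      f = {x ∈ convexHull ℝ (a '' V) | ∀ y ∈ convexHull ℝ (a '' V), u x ≤ u y} →
      normalCone (convexHull ℝ (a '' V)) f = {u' : StrongDual ℝ (Fin n → ℝ) |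
        ∀ i ∈ V, (∀ j ∈ V, u (a i) ≤ u (a j)) → ∀ j ∈ V, u' (a i) ≤ u' (a j)} := by
    intro u f hf
    have hfe : IsExposed ℝ (convexHull ℝ (a '' V)) f := fun _ => ⟨-u, by simpa using hf⟩
    ext u'
    constructor
    · intro hu' i hi hmi j hj
      refine hu' (a i) ?_ (a j) (subset_convexHull ℝ _ ⟨j, hj, rfl⟩)
      rw [hf]
      exact ⟨subset_convexHull ℝ _ ⟨i, hi, rfl⟩, (hmin u _).2 hmi⟩
    · intro hu' x hx y hy
      rw [face_eq_convexHull hfin hfe] at hx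
      have h1 : -u' y ≤ (-u') x := by
        refine le_of_mem_convexHull (-u') ?_ hx
        rintro _ ⟨hif, i, hi, rfl⟩
        rw [hf] at hif
        exact neg_le_neg ((hmin u' _).2 (hu' i hi ((hmin u _).1 hif.2)) y hy)
      exact neg_le_neg_iff.1 h1
  ext σ
  constructor
  · rintro ⟨f, hf, rfl⟩
    obtain ⟨-, u, hu⟩ := mem_faces_iff.1 hf
    exact ⟨u, (key u f hu).symm⟩
  · rintro ⟨u, rfl⟩
    refine ⟨_, mem_faces_iff.2 ⟨?_, u, rfl⟩, key u _ rfl⟩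
    obtain ⟨i, hi, hm⟩ := Set.exists_min_image V (fun i => u (a i)) hV hne
    exact ⟨a i, subset_convexHull ℝ _ ⟨i, hi, rfl⟩, (hmin u _).2 hm⟩

/-! ### Coordinates with respect to a lattice basis -/

/-- The `i`-th coordinate with respect to a basis `e` of the lattice `ℤⁿ`, as a linear form
on `ℝⁿ`. -/
noncomputable def latticeCoord {n : ℕ} (e : Module.Basis (Fin n) ℤ (Fin n → ℤ)) (i : Fin n) :
    StrongDual ℝ (Fin n → ℝ) :=
  ∑ j, ((e.repr (Pi.single j 1) i : ℤ) : ℝ) • ContinuousLinearMap.proj j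

section LatticeCoord

variable {n : ℕ} (e : Module.Basis (Fin n) ℤ (Fin n → ℤ))

theorem latticeCoord_apply (i : Fin n) (y : Fin n → ℝ) :
    latticeCoord e i y = ∑ j, ((e.repr (Pi.single j 1) i : ℤ) : ℝ) * y j := by
  simp [latticeCoord]

theorem repr_apply_eq_sum (m : Fin n → ℤ) (i : Fin n) :
    e.repr m i = ∑ j, e.repr (Pi.single j 1) i * m j := by
  conv_lhs => rw [← Finset.univ_sum_single m]
  rw [map_sum, Finsupp.finsetSum_apply]
  refine Finset.sum_congr rfl fun j _ => ?_
  rw [show Pi.single j (m j) = m j • (Pi.single j 1 : Fin n → ℤ) by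
    rw [← Pi.single_smul, smul_eq_mul, mul_one], map_smul, Finsupp.smul_apply,
    smul_eq_mul, mul_comm]

@[simp]
theorem latticeCoord_latticeToReal (m : Fin n → ℤ) (i : Fin n) :
    latticeCoord e i (latticeToReal m) = (e.repr m i : ℤ) := by
  rw [latticeCoord_apply, repr_apply_eq_sum]
  simp [latticeToReal]

theorem latticeCoord_basis (i k : Fin n) :
    latticeCoord e i (latticeToReal (e k)) = if k = i then 1 else 0 := by
  rw [latticeCoord_latticeToReal, e.repr_self, Finsupp.single_apply]
  split_ifs <;> simp

theorem sum_latticeCoord_smul (y : Fin n → ℝ) :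
    ∑ i, latticeCoord e i y • latticeToReal (e i) = y := by
  ext k
  have h : ∀ j, ∑ i, ((e.repr (Pi.single j 1) i : ℤ) : ℝ) * (e i k : ℝ) =
      if k = j then 1 else 0 := fun j => by
    have := congrFun (e.sum_repr (Pi.single j 1)) k
    simp only [Finset.sum_apply, Pi.smul_apply, smul_eq_mul, Pi.single_apply] at this
    exact_mod_cast this
  simp only [Finset.sum_apply, Pi.smul_apply, smul_eq_mul, latticeCoord_apply, latticeToReal,
    Finset.sum_mul]
  rw [Finset.sum_comm]
  calc ∑ j, ∑ i, ((e.repr (Pi.single j 1) i : ℤ) : ℝ) * y j * (e i k : ℝ)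
      = ∑ j, y j * ∑ i, ((e.repr (Pi.single j 1) i : ℤ) : ℝ) * (e i k : ℝ) := by
        simp only [Finset.mul_sum]
        exact Finset.sum_congr rfl fun j _ => Finset.sum_congr rfl fun i _ => by ring
    _ = y k := by simp [h]

theorem dual_eq_sum_latticeCoord (u : StrongDual ℝ (Fin n → ℝ)) (y : Fin n → ℝ) :
    u y = ∑ i, latticeCoord e i y * u (latticeToReal (e i)) := by
  conv_lhs => rw [← sum_latticeCoord_smul e y, map_sum]
  simp

theorem dual_eq_add_sum_latticeCoord (u : StrongDual ℝ (Fin n → ℝ)) (y v : Fin n → ℝ) :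
    u y = u v + ∑ i, latticeCoord e i (y - v) * u (latticeToReal (e i)) := by
  rw [← dual_eq_sum_latticeCoord, map_sub]
  ring

theorem le_of_latticeCoord_nonneg {u : StrongDual ℝ (Fin n → ℝ)}
    (hu : ∀ i, 0 ≤ u (latticeToReal (e i))) {y v : Fin n → ℝ}
    (hy : ∀ i, 0 ≤ latticeCoord e i (y - v)) : u v ≤ u y := by
  rw [dual_eq_add_sum_latticeCoord e u y v]
  exact le_add_of_nonneg_right (Finset.sum_nonneg fun i _ => mul_nonneg (hy i) (hu i))

/-- On the cone with apex `v` spanned by the basis, a linear form that is nonnegative on the basis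
takes its minimum at the points whose coordinates vanish in the directions in which the form is
positive. -/
theorem le_iff_of_latticeCoord_nonneg {u : StrongDual ℝ (Fin n → ℝ)}
    (hu : ∀ i, 0 ≤ u (latticeToReal (e i))) {y v : Fin n → ℝ}
    (hy : ∀ i, 0 ≤ latticeCoord e i (y - v)) :
    u y ≤ u v ↔ ∀ i, u (latticeToReal (e i)) = 0 ∨ latticeCoord e i (y - v) = 0 := by
  have h0 : ∀ i ∈ Finset.univ, 0 ≤ latticeCoord e i (y - v) * u (latticeToReal (e i)) :=
    fun i _ => mul_nonneg (hy i) (hu i)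
  rw [dual_eq_add_sum_latticeCoord e u y v, add_le_iff_nonpos_right,
    (Finset.sum_nonneg h0).ge_iff_eq', Finset.sum_eq_zero_iff_of_nonneg h0]
  simp [or_comm]

theorem ext_latticeCoord {x y : Fin n → ℝ} (h : ∀ i, latticeCoord e i x = latticeCoord e i y) :
    x = y := by
  rw [← sum_latticeCoord_smul e x, ← sum_latticeCoord_smul e y]
  simp only [h]

theorem latticeCoord_sum_smul (c : Fin n → ℝ) (k : Fin n) :
    latticeCoord e k (∑ i, c i • latticeToReal (e i)) = c k := by
  simp only [map_sum, map_smul, latticeCoord_basis, smul_eq_mul, mul_ite, mul_one, mul_zero]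
  simp

theorem linearIndependent_latticeToReal : LinearIndependent ℝ fun i => latticeToReal (e i) := by
  rw [Fintype.linearIndependent_iff]
  intro c hc i
  rw [← latticeCoord_sum_smul e c i, hc, map_zero]

end LatticeCoord

/-! ### Smooth corners of polytopes and the faces at a corner -/

/-- `v` is a vertex of `P` whose tangent cone is spanned by the lattice basis `e`: all points of `P`
have nonnegative coordinates with respect to `v` and `e`, and `P` contains a segment from `v` in
the direction of each basis vector. -/
structure IsSmoothCorner {n : ℕ} (P : Set (Fin n → ℝ)) (v : Fin n → ℝ)
    (e : Module.Basis (Fin n) ℤ (Fin n → ℤ)) : Prop where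
  mem : v ∈ P
  nonneg : ∀ y ∈ P, ∀ i, 0 ≤ latticeCoord e i (y - v)
  edge : ∀ i, ∃ ε : ℝ, 0 < ε ∧ v + ε • latticeToReal (e i) ∈ P

/-- The face at a corner that is spanned by the edges with directions `e i`, `i ∈ J`. -/
def cornerFace {n : ℕ} (P : Set (Fin n → ℝ)) (v : Fin n → ℝ)
    (e : Module.Basis (Fin n) ℤ (Fin n → ℤ)) (J : Finset (Fin n)) : Set (Fin n → ℝ) :=
  {y ∈ P | ∀ i ∉ J, latticeCoord e i (y - v) = 0}

/-- The cone of the linear forms that are nonnegative on the basis `e` and vanish on the basis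
vectors `e i`, `i ∈ J`. -/
def cornerCone {n : ℕ} (e : Module.Basis (Fin n) ℤ (Fin n → ℤ)) (J : Finset (Fin n)) :
    Set (StrongDual ℝ (Fin n → ℝ)) :=
  {u | (∀ i, 0 ≤ u (latticeToReal (e i))) ∧ ∀ i ∈ J, u (latticeToReal (e i)) = 0}

theorem latticeCoord_mem_cornerCone {n : ℕ} (e : Module.Basis (Fin n) ℤ (Fin n → ℤ))
    {J : Finset (Fin n)} {i : Fin n} (hi : i ∉ J) : latticeCoord e i ∈ cornerCone e J := by
  refine ⟨fun k => ?_, fun k hk => ?_⟩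
  · rw [latticeCoord_basis]
    split_ifs <;> norm_num
  · rw [latticeCoord_basis, if_neg]
    rintro rfl
    exact hi hk

theorem IsDelzant.exists_isSmoothCorner {n : ℕ} {P : Set (Fin n → ℝ)} (hP : IsDelzant P)
    {v : Fin n → ℝ} (hv : v ∈ P.extremePoints ℝ) :
    ∃ e : Module.Basis (Fin n) ℤ (Fin n → ℤ), IsSmoothCorner P v e := by
  obtain ⟨e, he⟩ := hP.smooth v hv
  refine ⟨e, hv.1, fun y hy i => ?_, fun i => ?_⟩
  · obtain ⟨c, hc, hyc⟩ := (he (y - v)).1 ⟨1, one_pos, by simpa using hy⟩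
    rw [hyc, latticeCoord_sum_smul]
    exact hc i
  · refine (he _).2 ⟨Pi.single i 1, fun k => ?_, ?_⟩
    · rw [Pi.single_apply]
      split_ifs <;> norm_num
    · simp [Pi.single_apply, ite_smul]

namespace IsSmoothCorner

variable {n : ℕ} {P : Set (Fin n → ℝ)} {v : Fin n → ℝ} {e : Module.Basis (Fin n) ℤ (Fin n → ℤ)}

theorem le_of_nonneg (h : IsSmoothCorner P v e) {u : StrongDual ℝ (Fin n → ℝ)}
    (hu : ∀ i, 0 ≤ u (latticeToReal (e i))) {y : Fin n → ℝ} (hy : y ∈ P) : u v ≤ u y :=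
  le_of_latticeCoord_nonneg e hu (h.nonneg y hy)

/-- The linear forms with minimum at a corner are those that are nonnegative on the edges. -/
theorem forall_le_iff (h : IsSmoothCorner P v e) (u : StrongDual ℝ (Fin n → ℝ)) :
    (∀ y ∈ P, u v ≤ u y) ↔ ∀ i, 0 ≤ u (latticeToReal (e i)) := by
  refine ⟨fun hu i => ?_, fun hu y hy => h.le_of_nonneg hu hy⟩
  obtain ⟨ε, hε, hm⟩ := h.edge i
  have := hu _ hm
  rw [map_add, map_smul, smul_eq_mul] at this
  exact nonneg_of_mul_nonneg_right (le_add_iff_nonneg_right _ |>.1 this) hε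

theorem le_iff_of_nonneg (h : IsSmoothCorner P v e) {u : StrongDual ℝ (Fin n → ℝ)}
    (hu : ∀ i, 0 ≤ u (latticeToReal (e i))) {y : Fin n → ℝ} (hy : y ∈ P) :
    u y ≤ u v ↔ ∀ i, u (latticeToReal (e i)) = 0 ∨ latticeCoord e i (y - v) = 0 :=
  le_iff_of_latticeCoord_nonneg e hu (h.nonneg y hy)

theorem mem_cornerFace (h : IsSmoothCorner P v e) (J : Finset (Fin n)) : v ∈ cornerFace P v e J :=
  ⟨h.mem, by simp⟩

theorem edge_mem_cornerFace {J : Finset (Fin n)} {i : Fin n} {ε : ℝ} (hε : ε ≠ 0)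
    (hm : v + ε • latticeToReal (e i) ∈ P) :
    v + ε • latticeToReal (e i) ∈ cornerFace P v e J ↔ i ∈ J := by
  refine ⟨fun hf => ?_, fun hi => ⟨hm, fun k hk => ?_⟩⟩
  · by_contra hi
    have := hf.2 i hi
    rw [add_sub_cancel_left, map_smul, latticeCoord_basis, if_pos rfl] at this
    simp [hε] at this
  · rw [add_sub_cancel_left, map_smul, latticeCoord_basis, if_neg, smul_zero]
    rintro rfl
    exact hk hi

theorem cornerFace_injective (h : IsSmoothCorner P v e) :
    Function.Injective (cornerFace P v e) := by
  intro J J' hJ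
  ext i
  obtain ⟨ε, hε, hm⟩ := h.edge i
  rw [← edge_mem_cornerFace hε.ne' hm, hJ, edge_mem_cornerFace hε.ne' hm]

theorem mem_cornerFace_iff_le (h : IsSmoothCorner P v e) (J : Finset (Fin n)) {y : Fin n → ℝ}
    (hy : y ∈ P) : y ∈ cornerFace P v e J ↔ ∀ u ∈ cornerCone e J, u y ≤ u v := by
  refine ⟨fun hf u hu => (h.le_iff_of_nonneg hu.1 hy).2 fun i => ?_, fun hu => ⟨hy, fun i hi => ?_⟩⟩
  · by_cases hi : i ∈ J
    · exact Or.inl (hu.2 i hi)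
    · exact Or.inr (hf.2 i hi)
  · have h1 := hu _ (latticeCoord_mem_cornerCone e hi)
    have h2 := h.nonneg y hy i
    rw [map_sub] at h2 ⊢
    linarith

theorem cornerFace_mem_faces (h : IsSmoothCorner P v e) (J : Finset (Fin n)) :
    cornerFace P v e J ∈ faces P := by
  refine mem_faces_iff.2 ⟨⟨v, h.mem_cornerFace J⟩, ∑ i ∈ Finset.univ \ J, latticeCoord e i, ?_⟩
  set u : StrongDual ℝ (Fin n → ℝ) := ∑ i ∈ Finset.univ \ J, latticeCoord e i with hu
  have hue : ∀ k, u (latticeToReal (e k)) = if k ∈ J then 0 else 1 := fun k => by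
    rw [hu, sum_apply]
    simp only [latticeCoord_basis]
    rw [Finset.sum_ite_eq]
    by_cases hk : k ∈ J <;> simp [hk]
  have hu0 : ∀ i, 0 ≤ u (latticeToReal (e i)) := fun i => by
    rw [hue]
    split_ifs <;> norm_num
  ext y
  constructor
  · intro hy
    refine ⟨hy.1, fun z hz => ?_⟩
    refine ((h.le_iff_of_nonneg hu0 hy.1).2 fun i => ?_).trans (h.le_of_nonneg hu0 hz)
    by_cases hi : i ∈ J
    · exact Or.inl (by rw [hue, if_pos hi])
    · exact Or.inr (hy.2 i hi)
  · rintro ⟨hy, hm⟩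
    refine ⟨hy, fun i hi => ?_⟩
    refine ((h.le_iff_of_nonneg hu0 hy).1 (hm v h.mem) i).resolve_left ?_
    rw [hue, if_neg hi]
    exact one_ne_zero

/-- Every face that contains a corner is one of the faces spanned by edges at the corner. -/
theorem exists_eq_cornerFace (h : IsSmoothCorner P v e) {f : Set (Fin n → ℝ)} (hf : f ∈ faces P)
    (hv : v ∈ f) : ∃ J, f = cornerFace P v e J := by
  classical
  obtain ⟨-, u, rfl⟩ := mem_faces_iff.1 hf
  have hu0 := (h.forall_le_iff u).1 hv.2
  refine ⟨Finset.univ.filter fun i => u (latticeToReal (e i)) = 0, ?_⟩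
  ext y
  refine and_congr_right fun hy => ?_
  have : (∀ z ∈ P, u y ≤ u z) ↔ u y ≤ u v :=
    ⟨fun hz => hz v h.mem, fun hz z hzP => hz.trans (h.le_of_nonneg hu0 hzP)⟩
  rw [this, h.le_iff_of_nonneg hu0 hy]
  simp [or_iff_not_imp_left]

theorem normalCone_cornerFace (h : IsSmoothCorner P v e) (J : Finset (Fin n)) :
    normalCone P (cornerFace P v e J) = cornerCone e J := by
  ext u
  constructor
  · intro hu
    have hu0 := (h.forall_le_iff u).1 (hu v (h.mem_cornerFace J))
    refine ⟨hu0, fun i hi => le_antisymm ?_ (hu0 i)⟩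
    obtain ⟨ε, hε, hm⟩ := h.edge i
    have := hu _ ((edge_mem_cornerFace hε.ne' hm).2 hi) v h.mem
    rw [map_add, map_smul, smul_eq_mul] at this
    exact nonpos_of_mul_nonpos_right (add_le_iff_nonpos_right _ |>.1 this) hε
  · intro hu x hx y hy
    exact ((h.mem_cornerFace_iff_le J hx.1).1 hx u hu).trans (h.le_of_nonneg hu.1 hy)

theorem cornerFace_empty (h : IsSmoothCorner P v e) : cornerFace P v e ∅ = {v} := by
  refine Set.Subset.antisymm (fun y hy => ?_) (by simpa using h.mem_cornerFace ∅)
  refine ext_latticeCoord e fun i => ?_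
  rw [← sub_eq_zero, ← map_sub]
  exact hy.2 i (by simp)

theorem cornerFace_univ : cornerFace P v e Finset.univ = P := by
  ext y
  simp [cornerFace]

theorem faceDim_cornerFace (h : IsSmoothCorner P v e) (J : Finset (Fin n)) :
    faceDim (cornerFace P v e J) = J.card := by
  have hspan : vectorSpan ℝ (cornerFace P v e J) =
      Submodule.span ℝ (Set.range fun i : J => latticeToReal (e i)) := by
    apply le_antisymm
    · rw [vectorSpan_def, Submodule.span_le]
      rintro _ ⟨x, hx, y, hy, rfl⟩
      change x - y ∈ _
      rw [← sum_latticeCoord_smul e (x - y)]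
      refine Submodule.sum_mem _ fun i _ => ?_
      by_cases hi : i ∈ J
      · exact Submodule.smul_mem _ _ (Submodule.subset_span ⟨⟨i, hi⟩, rfl⟩)
      · have : latticeCoord e i (x - y) = 0 := by
          rw [← sub_sub_sub_cancel_right x y v, map_sub, hx.2 i hi, hy.2 i hi, sub_zero]
        rw [this, zero_smul]
        exact Submodule.zero_mem _
    · rw [Submodule.span_le]
      rintro _ ⟨⟨i, hi⟩, rfl⟩
      obtain ⟨ε, hε, hm⟩ := h.edge i
      have := vsub_mem_vectorSpan ℝ ((edge_mem_cornerFace (J := J) hε.ne' hm).2 hi)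
        (h.mem_cornerFace J)
      rw [vsub_eq_sub, add_sub_cancel_left] at this
      exact (Submodule.smul_mem_iff _ hε.ne').1 this
  have hli : LinearIndependent ℝ fun i : J => latticeToReal (e i) :=
    (linearIndependent_latticeToReal e).comp _ Subtype.val_injective
  rw [faceDim, hspan, finrank_span_eq_card hli, Fintype.card_coe]

end IsSmoothCorner

theorem LatticePolytope.faceOfCone_cornerCone {n : ℕ} {Q : LatticePolytope n} {w : Fin n → ℝ}
    {e : Module.Basis (Fin n) ℤ (Fin n → ℤ)} (h : IsSmoothCorner Q.toSet w e) (J : Finset (Fin n)) :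
    Q.faceOfCone (cornerCone e J) = cornerFace Q.toSet w e J := by
  ext y
  constructor
  · rintro ⟨hy, hu⟩
    exact (h.mem_cornerFace_iff_le J hy).2 fun u hc => hu u hc w h.mem
  · intro hy
    exact ⟨hy.1, fun u hc z hz =>
      ((h.mem_cornerFace_iff_le J hy.1).1 hy u hc).trans (h.le_of_nonneg hc.1 hz)⟩

/-! ### Lattice polytopes with the normal fan of a Delzant polytope -/

theorem IsDelzant.finite_extremePoints {n : ℕ} {P : Set (Fin n → ℝ)} (hP : IsDelzant P) :
    (P.extremePoints ℝ).Finite := by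
  obtain ⟨S, -, rfl⟩ := hP.polytope
  exact S.finite_toSet.subset (extremePoints_convexHull_subset (𝕜 := ℝ))

theorem IsDelzant.convexHull_extremePoints {n : ℕ} {P : Set (Fin n → ℝ)} (hP : IsDelzant P) :
    convexHull ℝ (P.extremePoints ℝ) = P := by
  obtain ⟨S, -, rfl⟩ := hP.polytope
  exact convexHull_extremePoints_eq S.finite_toSet

theorem IsDelzant.extremePoints_nonempty {n : ℕ} {P : Set (Fin n → ℝ)} (hP : IsDelzant P) :
    (P.extremePoints ℝ).Nonempty := by
  obtain ⟨S, hS, rfl⟩ := hP.polytope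
  exact (S.finite_toSet.isCompact_convexHull (𝕜 := ℝ)).extremePoints_nonempty
    (convexHull_nonempty_iff.2 hS)

/-- The normal fan of a Delzant polytope is that of a lattice polytope. All relations between the
vertices that determine the fan are equations and strict inequalities with integral coefficients,
so a `ℚ`-linear map `ℝ → ℚ` close to the identity, applied to the coordinates of the vertices, does
not change them. -/
theorem IsDelzant.exists_latticePolytope {n : ℕ} {P : Set (Fin n → ℝ)} (hP : IsDelzant P) :
    ∃ Q : LatticePolytope n, normalFan Q.toSet = normalFan P := by
  classical
  have hfin := hP.finite_extremePoints
  obtain ⟨v₀, hv₀⟩ := hP.extremePoints_nonempty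
  have he : ∀ v, ∃ e : Module.Basis (Fin n) ℤ (Fin n → ℤ), v ∈ P.extremePoints ℝ →
      IsSmoothCorner P v e := fun v => by
    by_cases hv : v ∈ P.extremePoints ℝ
    · obtain ⟨e, he⟩ := hP.exists_isSmoothCorner hv
      exact ⟨e, fun _ => he⟩
    · exact ⟨Pi.basisFun ℤ (Fin n), fun h => absurd h hv⟩
  choose e he using he
  obtain ⟨φ, hφ⟩ := exists_rat_linearMap_tendsto
  have hev : ∀ᶠ k in Filter.atTop, ∀ v ∈ P.extremePoints ℝ, ∀ v' ∈ P.extremePoints ℝ, ∀ i,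
      0 < latticeCoord (e v) i (v' - v) → 0 < φ k (latticeCoord (e v) i (v' - v)) := by
    rw [Filter.eventually_all_finite hfin]
    intro v _
    rw [Filter.eventually_all_finite hfin]
    intro v' _
    rw [Filter.eventually_all]
    intro i
    by_cases h : 0 < latticeCoord (e v) i (v' - v)
    · exact ((hφ _).eventually (lt_mem_nhds h)).mono fun k hk _ => by exact_mod_cast hk
    · exact Filter.Eventually.of_forall fun k hk => absurd hk h
  obtain ⟨k, hk⟩ := hev.exists
  obtain ⟨N, hN, z, hz⟩ := exists_common_denominator
    (hfin.toFinset ×ˢ (Finset.univ : Finset (Fin n)))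
    fun p => φ k (p.1 p.2)
  let w : (Fin n → ℝ) → Fin n → ℤ := fun v j => z (v, j)
  have hw : ∀ v ∈ P.extremePoints ℝ, ∀ j, (w v j : ℚ) = N * φ k (v j) := fun v hv j =>
    hz (v, j) (by simpa using hv)
  have hcoord : ∀ v ∈ P.extremePoints ℝ, ∀ v' ∈ P.extremePoints ℝ, ∀ i,
      latticeCoord (e v) i (latticeToReal (w v') - latticeToReal (w v)) =
        ((N * φ k (latticeCoord (e v) i (v' - v)) : ℚ) : ℝ) := by
    intro v hv v' hv' i
    have h1 : latticeToReal (w v') - latticeToReal (w v) =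
        fun j => ((N * φ k (v' j - v j) : ℚ) : ℝ) := by
      ext j
      have : ((w v' j : ℚ) - (w v j : ℚ) : ℚ) = N * φ k (v' j - v j) := by
        rw [hw v hv, hw v' hv', map_sub, mul_sub]
      rw [← this]
      simp [latticeToReal]
    have h2 : ∀ (a : ℤ) (x : ℝ), φ k ((a : ℝ) * x) = a * φ k x := fun a x => by
      rw [← zsmul_eq_mul, map_zsmul, zsmul_eq_mul]
    rw [h1, latticeCoord_apply, latticeCoord_apply, map_sum, Finset.mul_sum]
    push_cast
    refine Finset.sum_congr rfl fun j _ => ?_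
    rw [h2, Pi.sub_apply]
    push_cast
    ring
  have hNpos : (0 : ℚ) < N := by exact_mod_cast hN
  have hpos : ∀ v ∈ P.extremePoints ℝ, ∀ v' ∈ P.extremePoints ℝ, ∀ i,
      0 ≤ latticeCoord (e v) i (latticeToReal (w v') - latticeToReal (w v)) ∧
      (latticeCoord (e v) i (latticeToReal (w v') - latticeToReal (w v)) = 0 ↔
        latticeCoord (e v) i (v' - v) = 0) := by
    intro v hv v' hv' i
    rw [hcoord v hv v' hv']
    rcases ((he v hv).nonneg v' hv'.1 i).eq_or_lt with h | h
    · rw [← h]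
      simp
    · have h3 := mul_pos hNpos (hk v hv v' hv' i h)
      exact ⟨by exact_mod_cast h3.le, iff_of_false (by exact_mod_cast h3.ne') h.ne'⟩
  refine ⟨⟨hfin.toFinset.image w, ⟨w v₀, Finset.mem_image_of_mem _ (by simpa using hv₀)⟩⟩, ?_⟩
  have hQ : LatticePolytope.toSet ⟨hfin.toFinset.image w,
      ⟨w v₀, Finset.mem_image_of_mem _ (by simpa using hv₀)⟩⟩ =
      convexHull ℝ ((fun v => latticeToReal (w v)) '' P.extremePoints ℝ) := by
    simp [LatticePolytope.toSet, Set.image_image]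
  have hPe : P = convexHull ℝ (id '' P.extremePoints ℝ) := by
    rw [Set.image_id, hP.convexHull_extremePoints]
  rw [hQ, normalFan_convexHull hfin ⟨v₀, hv₀⟩]
  conv_rhs => rw [hPe, normalFan_convexHull hfin ⟨v₀, hv₀⟩]
  -- A linear form is minimal at the same vertices before and after the approximation.
  have key : ∀ u : StrongDual ℝ (Fin n → ℝ), ∀ v ∈ P.extremePoints ℝ,
      (∀ v' ∈ P.extremePoints ℝ, u (latticeToReal (w v)) ≤ u (latticeToReal (w v'))) ↔
        ∀ v' ∈ P.extremePoints ℝ, u (id v) ≤ u (id v') := by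
    intro u v hv
    obtain ⟨v₁, hv₁, hmin⟩ := Set.exists_min_image _ (fun v => u v) hfin ⟨v₀, hv₀⟩
    have hu0 : ∀ i, 0 ≤ u (latticeToReal (e v₁ i)) := by
      refine ((he v₁ hv₁).forall_le_iff u).1 fun y hy => ?_
      rw [← hP.convexHull_extremePoints] at hy
      exact le_of_mem_convexHull u hmin hy
    have h1 : (∀ v' ∈ P.extremePoints ℝ, u (id v) ≤ u (id v')) ↔ u v ≤ u v₁ :=
      ⟨fun h => h v₁ hv₁, fun h v' hv' => h.trans (hmin v' hv')⟩
    have h2 : (∀ v' ∈ P.extremePoints ℝ, u (latticeToReal (w v)) ≤ u (latticeToReal (w v'))) ↔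
        u (latticeToReal (w v)) ≤ u (latticeToReal (w v₁)) :=
      ⟨fun h => h v₁ hv₁, fun h v' hv' => h.trans
        (le_of_latticeCoord_nonneg (e v₁) hu0 fun i => (hpos v₁ hv₁ v' hv' i).1)⟩
    rw [h1, h2, le_iff_of_latticeCoord_nonneg (e v₁) hu0 ((he v₁ hv₁).nonneg v hv.1),
      le_iff_of_latticeCoord_nonneg (e v₁) hu0 fun i => (hpos v₁ hv₁ v hv i).1]
    simp only [(hpos v₁ hv₁ v hv _).2]
  congr 1
  ext u u'
  refine forall₂_congr fun v hv => ?_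
  rw [key u v hv, key u' v hv]

/-- A vertex of a lattice polytope with the normal fan of a Delzant polytope `P` is a smooth corner,
with the same lattice basis as some corner of `P`, and the neighbouring lattice points along the
edges belong to the lattice polytope. -/
theorem LatticePolytope.exists_isSmoothCorner {n : ℕ} {P : Set (Fin n → ℝ)} (hP : IsDelzant P)
    {Q : LatticePolytope n} (hQ : normalFan Q.toSet = normalFan P) {w : Fin n → ℝ}
    (hw : w ∈ Q.toSet.extremePoints ℝ) :
    ∃ (w₀ : Fin n → ℤ) (v : Fin n → ℝ) (e : Module.Basis (Fin n) ℤ (Fin n → ℤ)),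
      w = latticeToReal w₀ ∧ IsSmoothCorner P v e ∧ IsSmoothCorner Q.toSet w e ∧
      ∀ i, latticeToReal (w₀ + e i) ∈ Q.toSet := by
  classical
  have hfin : (latticeToReal '' (Q.generators : Set (Fin n → ℤ))).Finite :=
    Q.generators.finite_toSet.image _
  obtain ⟨w₀, hw₀, hww⟩ := extremePoints_convexHull_subset (𝕜 := ℝ) hw
  obtain ⟨u, hu⟩ := exists_forall_lt_of_extremePoint hfin hw
  have hle : ∀ y ∈ Q.toSet, u w ≤ u y := fun y hy => by
    refine le_of_mem_convexHull u (fun s hs => ?_) hy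
    by_cases hsw : s = w
    · rw [hsw]
    · exact (hu s hs hsw).le
  -- Small perturbations of `u` are still minimal at `w`.
  have hpert : ∀ l : StrongDual ℝ (Fin n → ℝ), ∃ δ : ℝ, 0 < δ ∧
      u + δ • l ∈ normalCone Q.toSet {w} := by
    intro l
    have hev : ∀ᶠ δ : ℝ in nhdsWithin 0 (Set.Ioi 0),
        ∀ s ∈ latticeToReal '' (Q.generators : Set (Fin n → ℤ)), (u + δ • l) w ≤ (u + δ • l) s := by
      rw [Filter.eventually_all_finite hfin]
      intro s hs
      by_cases hsw : s = w
      · exact Filter.Eventually.of_forall fun δ => by rw [hsw]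
      have hc : Continuous fun δ : ℝ => (u + δ • l) s - (u + δ • l) w := by
        simp only [add_apply, smul_apply]
        fun_prop
      have h0 : 0 < (u + (0 : ℝ) • l) s - (u + (0 : ℝ) • l) w := by
        simpa using hu s hs hsw
      refine ((hc.tendsto 0).mono_left nhdsWithin_le_nhds).eventually (lt_mem_nhds h0) |>.mono ?_
      exact fun δ hδ => (sub_pos.1 hδ).le
    obtain ⟨δ, hδ, hpos⟩ := (hev.and self_mem_nhdsWithin).exists
    refine ⟨δ, hpos, ?_⟩
    rintro _ rfl y hy
    exact le_of_mem_convexHull _ hδ hy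
  have hface : {w} ∈ faces Q.toSet := by
    refine mem_faces_iff.2 ⟨⟨w, rfl⟩, u, ?_⟩
    refine Set.Subset.antisymm (by rintro _ rfl; exact ⟨hw.1, hle⟩) fun y hy => ?_
    have hmin : {x ∈ Q.toSet | ∀ y ∈ Q.toSet, u x ≤ u y} ∈ faces Q.toSet :=
      mem_faces_iff.2 ⟨⟨w, hw.1, hle⟩, u, rfl⟩
    have hfe : IsExposed ℝ (convexHull ℝ (latticeToReal '' (Q.generators : Set (Fin n → ℤ))))
        {x ∈ Q.toSet | ∀ y ∈ Q.toSet, u x ≤ u y} := hmin.2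
    rw [face_eq_convexHull hfin hfe] at hy
    refine convexHull_min ?_ (convex_singleton w) hy
    rintro s ⟨hs, hsg⟩
    by_contra hsw
    exact absurd (hs.2 w hw.1) (hu s hsg hsw).not_ge
  have hmem : normalCone Q.toSet {w} ∈ normalFan P := hQ ▸ ⟨_, hface, rfl⟩
  obtain ⟨f, hf, hcone⟩ := hmem
  obtain ⟨v, hv⟩ := hf.1
  have hfP : f ⊆ P := hf.2.subset
  -- The normal cone of `f` has interior points, so `f` is a single point.
  have hfv : f = {v} := by
    refine Set.Subset.antisymm (fun x hx => ?_) (by simpa using hv)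
    have heq : ∀ u' ∈ normalCone P f, u' x = u' v := fun u' hu' =>
      le_antisymm (hu' x hx v (hfP hv)) (hu' v hv x (hfP hx))
    have hu0 : u x = u v := heq u (by rw [hcone]; rintro _ rfl; exact hle)
    have hl : ∀ l : StrongDual ℝ (Fin n → ℝ), l x = l v := fun l => by
      obtain ⟨δ, hδ, hm⟩ := hpert l
      have h1 := heq _ (by rw [hcone]; exact hm)
      simp only [add_apply, smul_apply, smul_eq_mul, hu0] at h1
      exact mul_left_cancel₀ hδ.ne' (add_left_cancel h1)
    exact funext fun i => hl (ContinuousLinearMap.proj i)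
  have hvext : v ∈ P.extremePoints ℝ := by
    have := hf.2.isExtreme
    rwa [hfv, isExtreme_singleton] at this
  obtain ⟨e, he⟩ := hP.exists_isSmoothCorner hvext
  have hcone' : normalCone Q.toSet {w} = cornerCone e ∅ := by
    rw [← hcone, hfv, ← he.cornerFace_empty, he.normalCone_cornerFace]
  have hnonneg : ∀ y ∈ Q.toSet, ∀ i, 0 ≤ latticeCoord e i (y - w) := fun y hy i => by
    have : latticeCoord e i ∈ normalCone Q.toSet {w} := by
      rw [hcone']
      exact latticeCoord_mem_cornerCone e (Finset.notMem_empty i)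
    rw [map_sub, sub_nonneg]
    exact this w rfl y hy
  have hedge : ∀ i, latticeToReal (w₀ + e i) ∈ Q.toSet := by
    intro i
    -- Some generator lies on the ray from `w` spanned by `e i`. Otherwise every generator other
    -- than `w` has a positive coordinate different from the `i`-th, and a large multiple of the sum
    -- of these coordinates minus the `i`-th coordinate is a form in the normal cone that is
    -- negative on `e i`.
    have hray : ∃ s ∈ Q.generators, s ≠ w₀ ∧
        ∀ k ≠ i, latticeCoord e k (latticeToReal s - w) = 0 := by
      by_contra! hno
      have hM : ∀ s ∈ Q.generators, ∃ M : ℝ, 0 ≤ M ∧ latticeCoord e i (latticeToReal s - w) ≤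
          M * ∑ k ∈ Finset.univ.erase i, latticeCoord e k (latticeToReal s - w) := by
        intro s hs
        have hsQ : latticeToReal s ∈ Q.toSet := subset_convexHull ℝ _ ⟨s, hs, rfl⟩
        by_cases hsw : s = w₀
        · refine ⟨0, le_rfl, ?_⟩
          rw [hsw, hww, sub_self, map_zero, zero_mul]
        · obtain ⟨k, hki, hk⟩ := hno s hs hsw
          have hpos : 0 < ∑ k ∈ Finset.univ.erase i, latticeCoord e k (latticeToReal s - w) :=
            Finset.sum_pos' (fun k _ => hnonneg _ hsQ k) ⟨k, by simp [hki],
              (hnonneg _ hsQ k).lt_of_ne' hk⟩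
          exact ⟨_, div_nonneg (hnonneg _ hsQ i) hpos.le, (div_mul_cancel₀ _ hpos.ne').ge⟩
      choose! M hM0 hM using hM
      let l : StrongDual ℝ (Fin n → ℝ) :=
        (∑ s ∈ Q.generators, M s) • (∑ k ∈ Finset.univ.erase i, latticeCoord e k) - latticeCoord e i
      have hlapp : ∀ y, l y = (∑ s ∈ Q.generators, M s) *
          (∑ k ∈ Finset.univ.erase i, latticeCoord e k y) - latticeCoord e i y := fun y => by
        simp [l, sub_apply, smul_apply, sum_apply]
      have hlmem : l ∈ normalCone Q.toSet {w} := by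
        rintro _ rfl y hy
        refine le_of_mem_convexHull l ?_ hy
        rintro _ ⟨s, hs, rfl⟩
        rw [← sub_nonneg, ← map_sub, hlapp, sub_nonneg]
        refine (hM s hs).trans (mul_le_mul_of_nonneg_right ?_ ?_)
        · exact Finset.single_le_sum (fun s hs => hM0 s hs) hs
        · exact Finset.sum_nonneg fun k _ => hnonneg _ (subset_convexHull ℝ _ ⟨s, hs, rfl⟩) k
      rw [hcone'] at hlmem
      have hneg := hlmem.1 i
      have h0 : ∑ k ∈ Finset.univ.erase i, latticeCoord e k (latticeToReal (e i)) = 0 :=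
        Finset.sum_eq_zero fun k hk => by
          rw [latticeCoord_basis, if_neg (Finset.ne_of_mem_erase hk).symm]
      rw [hlapp, latticeCoord_basis, if_pos rfl, h0] at hneg
      norm_num at hneg
    obtain ⟨s, hs, hsw, hk⟩ := hray
    have hsQ : latticeToReal s ∈ Q.toSet := subset_convexHull ℝ _ ⟨s, hs, rfl⟩
    have hsub : latticeToReal s - w = latticeToReal (s - w₀) := by
      rw [← hww]
      ext j
      simp [latticeToReal]
    have hs1 : latticeToReal s - w = (e.repr (s - w₀) i : ℝ) • latticeToReal (e i) := by
      conv_lhs => rw [← sum_latticeCoord_smul e (latticeToReal s - w)]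
      rw [Finset.sum_eq_single i (fun k _ hki => by rw [hk k hki, zero_smul]) (by simp), hsub,
        latticeCoord_latticeToReal]
    have hc0 : (0 : ℝ) < (e.repr (s - w₀) i : ℝ) := by
      have h0 := hnonneg _ hsQ i
      rw [hsub, latticeCoord_latticeToReal] at h0
      refine h0.lt_of_ne' fun h => hsw ?_
      rw [h, zero_smul, ← hww, sub_eq_zero] at hs1
      exact latticeToReal_injective hs1
    have hc1 : (1 : ℝ) ≤ (e.repr (s - w₀) i : ℝ) := by
      have : 0 < e.repr (s - w₀) i := by exact_mod_cast hc0
      exact_mod_cast this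
    set c : ℝ := (e.repr (s - w₀) i : ℝ)
    have hseg : latticeToReal (w₀ + e i) = w + c⁻¹ • (latticeToReal s - w) := by
      rw [hs1, smul_smul, inv_mul_cancel₀ hc0.ne', one_smul, ← hww]
      ext j
      simp [latticeToReal]
    rw [hseg]
    exact (convex_convexHull ℝ _).add_smul_sub_mem hw.1 hsQ
      ⟨inv_nonneg.2 hc0.le, inv_le_one_of_one_le₀ hc1⟩
  refine ⟨w₀, v, e, hww.symm, he, ⟨hw.1, hnonneg, fun i => ⟨1, one_pos, ?_⟩⟩, hedge⟩
  have := hedge i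
  rwa [one_smul, ← hww, show latticeToReal w₀ + latticeToReal (e i) = latticeToReal (w₀ + e i) by
    ext j; simp [latticeToReal]]

/-! ### Zariski closures in projective space -/

namespace ProjSpace

/-- A homogeneous equation that holds on a set holds on its Zariski closure. -/
theorem eval_eq_zero_of_mem_closure {ι : Type} {S : Set (ProjSpace ι)} {d : ℕ}
    {F : MvPolynomial ι ℂ} (hF : F.IsHomogeneous d)
    (hS : ∀ p ∈ S, MvPolynomial.eval p.rep F = 0) {p : ProjSpace ι} (hp : p ∈ closure S) :
    MvPolynomial.eval p.rep F = 0 := by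
  have hsub : S ⊆ (basicOpen F)ᶜ := fun q hq h => h (hS q hq)
  have := closure_minimal hsub (isOpen_basicOpen hF).isClosed_compl hp
  exact not_not.1 this

theorem isTopologicalBasis_basicOpen (ι : Type) : TopologicalSpace.IsTopologicalBasis
    {U : Set (ProjSpace ι) | ∃ (d : ℕ) (F : MvPolynomial ι ℂ), F.IsHomogeneous d ∧
      U = basicOpen F} where
  exists_subset_inter := by
    rintro _ ⟨d, F, hF, rfl⟩ _ ⟨d', F', hF', rfl⟩ p hp
    refine ⟨basicOpen (F * F'), ⟨d + d', _, hF.mul hF', rfl⟩, ?_, fun q hq => ?_⟩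
    · simpa [basicOpen] using hp
    · simpa [basicOpen] using hq
  sUnion_eq := by
    refine Set.eq_univ_of_forall fun p =>
      ⟨basicOpen 1, ⟨0, 1, MvPolynomial.isHomogeneous_one _ _, rfl⟩, ?_⟩
    simp [basicOpen]
  eq_generateFrom := rfl

theorem mem_closure_of_forall_eval {ι : Type} {S : Set (ProjSpace ι)} {p : ProjSpace ι}
    {v : ι → ℂ} (hv : p.HasCoords v)
    (h : ∀ (d : ℕ) (F : MvPolynomial ι ℂ), F.IsHomogeneous d → MvPolynomial.eval v F ≠ 0 →
      ∃ q ∈ S, ∃ w, q.HasCoords w ∧ MvPolynomial.eval w F ≠ 0) : p ∈ closure S := by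
  rw [(isTopologicalBasis_basicOpen ι).mem_closure_iff]
  rintro _ ⟨d, F, hF, rfl⟩ hp
  obtain ⟨q, hq, w, hw, hne⟩ := h d F hF ((hv.mem_basicOpen hF).1 hp)
  exact ⟨q, (hw.mem_basicOpen hF).2 hne, hq⟩

end ProjSpace

/-- A nonzero complex polynomial does not vanish at some point of the torus. -/
theorem MvPolynomial.exists_units_eval_ne_zero {κ : Type} [Fintype κ] {H : MvPolynomial κ ℂ}
    (hH : H ≠ 0) : ∃ z : κ → ℂˣ, MvPolynomial.eval (fun i => (z i : ℂ)) H ≠ 0 := by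
  have hne : H * ∏ i, MvPolynomial.X i ≠ 0 :=
    mul_ne_zero hH (Finset.prod_ne_zero_iff.2 fun i _ => MvPolynomial.X_ne_zero i)
  obtain ⟨z, hz⟩ : ∃ z, MvPolynomial.eval z (H * ∏ i, MvPolynomial.X i) ≠ 0 := by
    by_contra! h
    exact hne (MvPolynomial.funext fun z => by rw [h z, map_zero])
  rw [map_mul, map_prod] at hz
  have hz' : ∀ i, z i ≠ 0 := fun i => by
    simpa using Finset.prod_ne_zero_iff.1 (right_ne_zero_of_mul hz) i (Finset.mem_univ i)
  exact ⟨fun i => Units.mk0 (z i) (hz' i), by simpa using left_ne_zero_of_mul hz⟩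

/-! ### Binomial equations of the torus orbits -/

/-- The character `t ↦ tᵐ` of the torus is additive in `m`. -/
theorem prod_zpow_add {n : ℕ} (t : Fin n → ℂˣ) (m m' : Fin n → ℤ) :
    ∏ i, t i ^ (m + m') i = (∏ i, t i ^ m i) * ∏ i, t i ^ m' i := by
  rw [← Finset.prod_mul_distrib]
  exact Finset.prod_congr rfl fun i _ => zpow_add _ _ _

theorem zpow_finset_sum {G κ : Type*} [CommGroup G] (a : G) (s : Finset κ) (f : κ → ℤ) :
    a ^ ∑ i ∈ s, f i = ∏ i ∈ s, a ^ f i := by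
  classical
  induction s using Finset.induction_on with
  | empty => simp
  | insert i s hi ih => rw [Finset.sum_insert hi, Finset.prod_insert hi, zpow_add, ih]

namespace LatticePolytope

variable {n : ℕ} {Q : LatticePolytope n} {σ : Set (StrongDual ℝ (Fin n → ℝ))}

/-- A linear form at a sum of lattice points. -/
theorem dual_sum_map (u : StrongDual ℝ (Fin n → ℝ)) (s : Multiset Q.LatticePoint) :
    (s.map fun m => u (latticeToReal m.1)).sum =
      u (latticeToReal (s.map fun m => m.1).sum) := by
  induction s using Multiset.induction_on with
  | empty =>
    have : latticeToReal (0 : Fin n → ℤ) = 0 := by ext; simp [latticeToReal]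
    simp [this]
  | cons m s ih =>
    have : ∀ a b : Fin n → ℤ, latticeToReal (a + b) = latticeToReal a + latticeToReal b :=
      fun a b => by ext; simp [latticeToReal]
    rw [Multiset.map_cons, Multiset.sum_cons, ih, Multiset.map_cons, Multiset.sum_cons, this,
      map_add]

/-- Two families of lattice points with the same number of elements and the same sum lie on the same
faces. -/
theorem forall_mem_faceOfCone_of_sum_eq {s t : Multiset Q.LatticePoint} (hcard : s.card = t.card)
    (hsum : (s.map fun m => m.1).sum = (t.map fun m => m.1).sum)
    (hs : ∀ m ∈ s, latticeToReal m.1 ∈ Q.faceOfCone σ) :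
    ∀ m ∈ t, latticeToReal m.1 ∈ Q.faceOfCone σ := by
  intro m hm
  refine ⟨m.2, fun u hu y hy => ?_⟩
  obtain ⟨t', rfl⟩ := Multiset.exists_cons_of_mem hm
  obtain ⟨m₀, hm₀⟩ : ∃ m₀, m₀ ∈ s := by
    refine Multiset.card_pos_iff_exists_mem.1 ?_
    rw [hcard, Multiset.card_cons]
    exact Nat.succ_pos _
  have hmin := (hs m₀ hm₀).2 u hu
  have h1 := congrArg (fun x => u (latticeToReal x)) hsum
  simp only [← dual_sum_map] at h1
  have h2 : (s.map fun m => u (latticeToReal m.1)).sum ≤ s.card • u (latticeToReal m₀.1) := by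
    rw [← Multiset.card_map (fun m : Q.LatticePoint => u (latticeToReal m.1)) s]
    refine Multiset.sum_le_card_nsmul _ _ fun x hx => ?_
    obtain ⟨m', hm', rfl⟩ := Multiset.mem_map.1 hx
    exact (hs m' hm').2 u hu _ m₀.2
  have h3 : t'.card • u (latticeToReal m₀.1) ≤ (t'.map fun m => u (latticeToReal m.1)).sum := by
    rw [← Multiset.card_map (fun m : Q.LatticePoint => u (latticeToReal m.1)) t']
    refine Multiset.card_nsmul_le_sum fun x hx => ?_
    obtain ⟨m', -, rfl⟩ := Multiset.mem_map.1 hx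
    exact hmin _ m'.2
  rw [h1, hcard, Multiset.card_cons, Multiset.map_cons, Multiset.sum_cons, succ_nsmul] at h2
  exact le_trans (by linarith) (hmin y hy)

theorem prod_orbitVector (t : Fin n → ℂˣ) {s : Multiset Q.LatticePoint}
    (hs : ∀ m ∈ s, latticeToReal m.1 ∈ Q.faceOfCone σ) :
    (s.map (Q.orbitVector σ t)).prod =
      ((∏ i, t i ^ (s.map fun m => m.1).sum i : ℂˣ) : ℂ) := by
  induction s using Multiset.induction_on with
  | empty => simp
  | cons m s ih =>
    rw [Multiset.map_cons, Multiset.prod_cons,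
      ih fun m' hm' => hs m' (Multiset.mem_cons_of_mem hm'),
      Multiset.map_cons, Multiset.sum_cons, prod_zpow_add, Units.val_mul, orbitVector,
      if_pos (hs m (Multiset.mem_cons_self m s))]

/-- The coordinates of the points of the closure of a torus orbit satisfy the binomial equations
given by the relations between the lattice points. -/
theorem prod_eq_of_mem_closure {p : ProjSpace Q.LatticePoint} (hp : p ∈ closure (Q.torusOrbit σ))
    {s t : Multiset Q.LatticePoint} (hcard : s.card = t.card)
    (hsum : (s.map fun m => m.1).sum = (t.map fun m => m.1).sum) :
    (s.map p.rep).prod = (t.map p.rep).prod := by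
  have hhom : ∀ s : Multiset Q.LatticePoint,
      ((s.map MvPolynomial.X).prod : MvPolynomial Q.LatticePoint ℂ).IsHomogeneous s.card := by
    intro s
    induction s using Multiset.induction_on with
    | empty => simpa using MvPolynomial.isHomogeneous_one _ _
    | cons m s ih =>
      rw [Multiset.map_cons, Multiset.prod_cons, Multiset.card_cons, add_comm]
      exact (MvPolynomial.isHomogeneous_X ℂ m).mul ih
  have heval : ∀ (v : Q.LatticePoint → ℂ) (s : Multiset Q.LatticePoint),
      MvPolynomial.eval v (s.map MvPolynomial.X).prod = (s.map v).prod := by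
    intro v s
    rw [map_multiset_prod, Multiset.map_map]
    simp
  have hF := (hhom s).sub (hcard ▸ hhom t)
  have := ProjSpace.eval_eq_zero_of_mem_closure hF (fun q hq => ?_) hp
  · rwa [map_sub, heval, heval, sub_eq_zero] at this
  obtain ⟨τ, hτ⟩ := hq
  obtain ⟨a, -, ha⟩ := q.hasCoords_rep.exists_smul hτ
  rw [map_sub, heval, heval, sub_eq_zero, ha]
  have hsmul : ∀ s : Multiset Q.LatticePoint, (s.map (a • Q.orbitVector σ τ)).prod =
      a ^ s.card * (s.map (Q.orbitVector σ τ)).prod := fun s => by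
    simp [Multiset.prod_map_mul]
  rw [hsmul, hsmul, hcard]
  congr 1
  by_cases hs : ∀ m ∈ s, latticeToReal m.1 ∈ Q.faceOfCone σ
  · rw [prod_orbitVector τ hs, prod_orbitVector τ (forall_mem_faceOfCone_of_sum_eq hcard hsum hs),
      hsum]
  · have ht : ¬ ∀ m ∈ t, latticeToReal m.1 ∈ Q.faceOfCone σ := fun ht =>
      hs (forall_mem_faceOfCone_of_sum_eq hcard.symm hsum.symm ht)
    push Not at hs ht
    obtain ⟨m, hm, hmσ⟩ := hs
    obtain ⟨m', hm', hmσ'⟩ := ht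
    rw [Multiset.prod_eq_zero (Multiset.mem_map.2 ⟨m, hm, if_neg hmσ⟩),
      Multiset.prod_eq_zero (Multiset.mem_map.2 ⟨m', hm', if_neg hmσ'⟩)]

theorem mem_faceOfCone_of_mem_closure {p : ProjSpace Q.LatticePoint}
    (hp : p ∈ closure (Q.torusOrbit σ)) {m : Q.LatticePoint} (hm : p.rep m ≠ 0) :
    latticeToReal m.1 ∈ Q.faceOfCone σ := by
  by_contra hmσ
  have := ProjSpace.eval_eq_zero_of_mem_closure (MvPolynomial.isHomogeneous_X ℂ m)
    (fun q hq => ?_) hp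
  · exact hm (by simpa using this)
  obtain ⟨τ, hτ⟩ := hq
  obtain ⟨a, -, ha⟩ := q.hasCoords_rep.exists_smul hτ
  rw [MvPolynomial.eval_X, ha, Pi.smul_apply, orbitVector, if_neg hmσ, smul_zero]

/-- A point of the closure of a torus orbit has a nonzero coordinate at some vertex. -/
theorem exists_extremePoint_of_mem_closure {p : ProjSpace Q.LatticePoint}
    (hp : p ∈ closure (Q.torusOrbit σ)) :
    ∃ m : Q.LatticePoint, latticeToReal m.1 ∈ Q.toSet.extremePoints ℝ ∧ p.rep m ≠ 0 := by
  classical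
  obtain ⟨m₀, hm₀⟩ := Function.ne_iff.1 p.hasCoords_rep.1
  have hfin : (latticeToReal '' (Q.generators : Set (Fin n → ℤ))).Finite :=
    Q.generators.finite_toSet.image _
  let G := Q.generators.filter fun y => latticeToReal y ∈ Q.toSet.extremePoints ℝ
  have hG : latticeToReal '' (G : Set (Fin n → ℤ)) = Q.toSet.extremePoints ℝ := by
    ext x
    constructor
    · rintro ⟨y, hy, rfl⟩
      exact (Finset.mem_filter.1 hy).2
    · intro hx
      obtain ⟨y, hy, rfl⟩ := extremePoints_convexHull_subset (𝕜 := ℝ) hx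
      exact ⟨y, Finset.mem_filter.2 ⟨hy, hx⟩, rfl⟩
  have hm₀G : latticeToReal m₀.1 ∈ convexHull ℝ (latticeToReal '' (G : Set (Fin n → ℤ))) := by
    rw [hG]
    exact (convexHull_extremePoints_eq hfin).symm.subset m₀.2
  obtain ⟨s, hs0, hsG, hsum⟩ := exists_multiset_of_mem_convexHull G m₀.1 hm₀G
  have hext : ∀ y ∈ s, latticeToReal y ∈ Q.toSet.extremePoints ℝ := fun y hy =>
    (Finset.mem_filter.1 (hsG y hy)).2
  let s' : Multiset Q.LatticePoint := s.attach.map fun y => ⟨y.1, (hext y.1 y.2).1⟩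
  have hs' : s'.map (fun m => m.1) = s :=
    (Multiset.map_map _ _ _).trans (Multiset.attach_map_val s)
  have hcard : s'.card = (Multiset.replicate s.card m₀).card :=
    (Multiset.card_map _ _).trans (Multiset.card_attach.trans (Multiset.card_replicate _ _).symm)
  have hrel := prod_eq_of_mem_closure hp hcard
    (by rw [hs', hsum, Multiset.map_replicate, Multiset.sum_replicate])
  rw [Multiset.map_replicate, Multiset.prod_replicate] at hrel
  obtain ⟨y, hy⟩ := Multiset.exists_mem_of_ne_zero hs0
  refine ⟨⟨y, (hext y hy).1⟩, hext y hy, fun h0 => ?_⟩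
  refine pow_ne_zero s.card (show p.rep m₀ ≠ 0 from hm₀) ?_
  rw [← hrel]
  refine Multiset.prod_eq_zero (Multiset.mem_map.2 ⟨_, Multiset.mem_map.2 ⟨⟨y, hy⟩, ?_, rfl⟩, h0⟩)
  exact Multiset.mem_attach _ _

/-! ### Affine charts at the smooth corners -/

/-- The homogeneous coordinates, as functions of `n` affine coordinates at the vertex `w` with
the lattice basis `e`: the coordinate at `m = w + ∑ i, c i • e i` is `∏ i, x i ^ c i`. -/
noncomputable def chartVector (Q : LatticePolytope n) (w : Fin n → ℤ)
    (e : Module.Basis (Fin n) ℤ (Fin n → ℤ)) (x : Fin n → ℂ) : Q.LatticePoint → ℂ :=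
  fun m => ∏ i, x i ^ (e.repr (m.1 - w) i).toNat

variable {w : Fin n → ℤ} {e : Module.Basis (Fin n) ℤ (Fin n → ℤ)}

theorem latticeCoord_sub (m : Fin n → ℤ) (i : Fin n) :
    latticeCoord e i (latticeToReal m - latticeToReal w) = (e.repr (m - w) i : ℤ) := by
  rw [← latticeCoord_latticeToReal]
  congr 1
  ext j
  simp [latticeToReal]

theorem toNat_repr (hw : IsSmoothCorner Q.toSet (latticeToReal w) e) (m : Q.LatticePoint)
    (i : Fin n) : ((e.repr (m.1 - w) i).toNat : ℤ) = e.repr (m.1 - w) i := by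
  refine Int.toNat_of_nonneg ?_
  have := hw.nonneg _ m.2 i
  rw [latticeCoord_sub] at this
  exact_mod_cast this

theorem mem_cornerFace_iff_repr (hw : IsSmoothCorner Q.toSet (latticeToReal w) e)
    (m : Q.LatticePoint) (J : Finset (Fin n)) :
    latticeToReal m.1 ∈ cornerFace Q.toSet (latticeToReal w) e J ↔
      ∀ i ∉ J, (e.repr (m.1 - w) i).toNat = 0 := by
  refine (and_iff_right m.2).trans (forall₂_congr fun i _ => ?_)
  rw [latticeCoord_sub, ← toNat_repr hw]
  norm_cast

theorem chartVector_vertex (x : Fin n → ℂ) (h : latticeToReal w ∈ Q.toSet) :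
    Q.chartVector w e x ⟨w, h⟩ = 1 := by
  simp [chartVector]

theorem edge_mem_cornerFace_iff (hw : IsSmoothCorner Q.toSet (latticeToReal w) e) (i : Fin n)
    (h : latticeToReal (w + e i) ∈ Q.toSet) (J : Finset (Fin n)) :
    latticeToReal (w + e i) ∈ cornerFace Q.toSet (latticeToReal w) e J ↔ i ∈ J := by
  rw [mem_cornerFace_iff_repr hw ⟨w + e i, h⟩ J]
  constructor
  · intro h'
    by_contra hi
    simpa using h' i hi
  · intro hi k hk
    have : i ≠ k := by rintro rfl; exact hk hi
    simp [this]

/-- The points of the closure of a torus orbit with nonzero coordinate at the vertex `w` are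
given by their affine coordinates at `w`. -/
theorem hasCoords_chartVector (hw : IsSmoothCorner Q.toSet (latticeToReal w) e)
    (hedge : ∀ i, latticeToReal (w + e i) ∈ Q.toSet) {p : ProjSpace Q.LatticePoint}
    (hp : p ∈ closure (Q.torusOrbit σ)) (h0 : p.rep ⟨w, hw.mem⟩ ≠ 0) :
    p.HasCoords (Q.chartVector w e fun i => p.rep ⟨w + e i, hedge i⟩ / p.rep ⟨w, hw.mem⟩) := by
  convert p.hasCoords_rep.smul (inv_ne_zero h0) using 1
  ext m
  let c : Fin n → ℕ := fun i => (e.repr (m.1 - w) i).toNat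
  have hm : m.1 - w = ∑ i, c i • e i := by
    conv_lhs => rw [← e.sum_repr (m.1 - w)]
    exact Finset.sum_congr rfl fun i _ => by rw [← toNat_repr hw, natCast_zsmul]
  let W : Q.LatticePoint := ⟨w, hw.mem⟩
  let E : Fin n → Q.LatticePoint := fun i => ⟨w + e i, hedge i⟩
  have hrel := prod_eq_of_mem_closure hp (s := m ::ₘ Multiset.replicate (∑ i, c i) W)
    (t := W ::ₘ ∑ i, Multiset.replicate (c i) (E i)) (by simp) (by
      have hE : ((∑ i, Multiset.replicate (c i) (E i)).map fun m => m.1).sum =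
          ∑ i, c i • (w + e i) := by
        rw [← Multiset.coe_mapAddMonoidHom, map_sum, Multiset.sum_sum]
        refine Finset.sum_congr rfl fun i _ => ?_
        rw [Multiset.coe_mapAddMonoidHom, Multiset.map_replicate, Multiset.sum_replicate]
      rw [Multiset.map_cons, Multiset.map_cons, Multiset.sum_cons, Multiset.sum_cons, hE,
        Multiset.map_replicate, Multiset.sum_replicate]
      simp only [smul_add, Finset.sum_add_distrib, ← hm, ← Finset.sum_smul]
      simp only [W]
      abel)
  have hE : ((∑ i, Multiset.replicate (c i) (E i)).map p.rep).prod = ∏ i, p.rep (E i) ^ c i := by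
    rw [← Multiset.coe_mapAddMonoidHom, map_sum, Multiset.prod_sum]
    simp
  rw [Multiset.map_cons, Multiset.map_cons, Multiset.prod_cons, Multiset.prod_cons, hE,
    Multiset.map_replicate, Multiset.prod_replicate] at hrel
  have hW : p.rep W ≠ 0 := h0
  change ∏ i, (p.rep (E i) / p.rep W) ^ c i = (p.rep W)⁻¹ * p.rep m
  simp only [div_pow, Finset.prod_div_distrib, Finset.prod_pow_eq_pow_sum]
  rw [div_eq_iff (pow_ne_zero _ hW), mul_assoc, hrel, inv_mul_cancel_left₀ hW]

open Classical in
/-- In the chart at a corner, a point of the torus orbit of a face at the corner has as affine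
coordinates any nonzero numbers in the directions of the face and zero in the others. -/
theorem exists_orbitVector_eq (hw : IsSmoothCorner Q.toSet (latticeToReal w) e)
    (J : Finset (Fin n)) (z : Fin n → ℂˣ) : ∃ (t : Fin n → ℂˣ) (a : ℂ), a ≠ 0 ∧
      Q.orbitVector (cornerCone e J) t = a • fun m : Q.LatticePoint =>
        if latticeToReal m.1 ∈ cornerFace Q.toSet (latticeToReal w) e J then
          Q.chartVector w e (fun i => (z i : ℂ)) m else 0 := by
  refine ⟨fun j => ∏ i, z i ^ e.repr (Pi.single j 1) i, ((∏ i, z i ^ e.repr w i : ℂˣ) : ℂ),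
    Units.ne_zero _, ?_⟩
  ext m
  rw [orbitVector, faceOfCone_cornerCone hw, Pi.smul_apply, smul_eq_mul]
  split_ifs with hm
  · have h1 : ∏ j, (∏ i, z i ^ e.repr (Pi.single j 1) i) ^ m.1 j = ∏ i, z i ^ e.repr m.1 i := by
      simp only [← Finset.prod_zpow, ← zpow_mul]
      rw [Finset.prod_comm]
      refine Finset.prod_congr rfl fun i _ => ?_
      rw [repr_apply_eq_sum e m.1 i, zpow_finset_sum]
    have h2 : ∏ i, z i ^ e.repr m.1 i =
        (∏ i, z i ^ e.repr w i) * ∏ i, z i ^ (e.repr (m.1 - w) i).toNat := by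
      rw [← Finset.prod_mul_distrib]
      refine Finset.prod_congr rfl fun i _ => ?_
      rw [← zpow_natCast, toNat_repr hw, ← zpow_add, map_sub, Finsupp.sub_apply,
        add_sub_cancel]
    rw [h1, h2, Units.val_mul, chartVector]
    simp
  · rw [mul_zero]

/-- In the chart at a corner, the closure of the torus orbit of a face at the corner contains
the coordinate subspace of the directions of the face. -/
theorem mem_closure_torusOrbit (hw : IsSmoothCorner Q.toSet (latticeToReal w) e)
    {J : Finset (Fin n)} {x : Fin n → ℂ} (hx : ∀ i ∉ J, x i = 0) {p : ProjSpace Q.LatticePoint}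
    (hp : p.HasCoords (Q.chartVector w e x)) : p ∈ closure (Q.torusOrbit (cornerCone e J)) := by
  classical
  let V : (Fin n → ℂ) → Q.LatticePoint → ℂ := fun y m =>
    if latticeToReal m.1 ∈ cornerFace Q.toSet (latticeToReal w) e J then
      Q.chartVector w e y m else 0
  have hV : V x = Q.chartVector w e x := by
    ext m
    simp only [V]
    split_ifs with hm
    · rfl
    · rw [mem_cornerFace_iff_repr hw] at hm
      push Not at hm
      obtain ⟨i, hi, hne⟩ := hm
      rw [chartVector, Finset.prod_eq_zero (Finset.mem_univ i)]
      rw [hx i hi, zero_pow hne]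
  refine ProjSpace.mem_closure_of_forall_eval (hV ▸ hp) fun d F _ hF => ?_
  let H : MvPolynomial (Fin n) ℂ := MvPolynomial.aeval (fun m : Q.LatticePoint =>
    if latticeToReal m.1 ∈ cornerFace Q.toSet (latticeToReal w) e J then
      ∏ i, MvPolynomial.X i ^ (e.repr (m.1 - w) i).toNat else 0) F
  have hH : ∀ y, MvPolynomial.eval y H = MvPolynomial.eval (V y) F := by
    intro y
    rw [← MvPolynomial.coe_aeval_eq_eval, ← MvPolynomial.coe_aeval_eq_eval]
    change (MvPolynomial.aeval y) (MvPolynomial.aeval _ F) = MvPolynomial.aeval (V y) F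
    rw [MvPolynomial.comp_aeval_apply]
    congr 2
    ext m
    simp only [V]
    split_ifs
    · simp [chartVector]
    · simp
  have hH0 : H ≠ 0 := by
    rintro h
    apply hF
    rw [← hH, h, map_zero]
  obtain ⟨z, hz⟩ := MvPolynomial.exists_units_eval_ne_zero hH0
  obtain ⟨t, a, ha, hta⟩ := exists_orbitVector_eq hw J z
  rw [hH] at hz
  have hVz : V (fun i => (z i : ℂ)) ≠ 0 := by
    refine Function.ne_iff.2 ⟨⟨w, hw.mem⟩, ?_⟩
    simp only [V]
    rw [if_pos (hw.mem_cornerFace J), chartVector_vertex]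
    exact one_ne_zero
  obtain ⟨q, hq⟩ := ProjSpace.exists_hasCoords hVz
  exact ⟨q, ⟨t, by rw [hta]; exact hq.smul ha⟩, _, hq, hz⟩

end LatticePolytope

/-! ### The strata of the toric variety and the faces of the Delzant polytope -/

theorem IsSmoothCorner.normalCone_self {n : ℕ} {P : Set (Fin n → ℝ)} {v : Fin n → ℝ}
    {e : Module.Basis (Fin n) ℤ (Fin n → ℤ)} (h : IsSmoothCorner P v e) :
    normalCone P P = cornerCone e Finset.univ := by
  rw [← h.normalCone_cornerFace, IsSmoothCorner.cornerFace_univ]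

namespace LatticePolytope

variable {n : ℕ} {P : Set (Fin n → ℝ)} {Q : LatticePolytope n}

/-- If the vertex of `Q` at a corner lies on the face that corresponds to a face `f` of `P`, then
the vertex of `P` at the corner with the same basis lies on `f`. -/
theorem vertex_mem_of_mem_faceOfCone {v w : Fin n → ℝ} {e : Module.Basis (Fin n) ℤ (Fin n → ℤ)}
    (hv : IsSmoothCorner P v e) (hw : IsSmoothCorner Q.toSet w e) {f : Set (Fin n → ℝ)}
    (hf : f ∈ faces P) (h : w ∈ Q.faceOfCone (normalCone P f)) : v ∈ f := by
  obtain ⟨-, u, hu⟩ := mem_faces_iff.1 hf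
  have huf : u ∈ normalCone P f := by
    intro x hx
    rw [hu] at hx
    exact hx.2
  rw [hu]
  exact ⟨hv.mem, (hv.forall_le_iff u).2 ((hw.forall_le_iff u).1 (h.2 u huf))⟩

/-- Every point of the closure of a torus orbit belongs to the chart at some corner, which is also
a corner of `P`. -/
theorem exists_corner_of_mem_closure (hP : IsDelzant P) (hQ : normalFan Q.toSet = normalFan P)
    {σ : Set (StrongDual ℝ (Fin n → ℝ))} {p : ProjSpace Q.LatticePoint}
    (hp : p ∈ closure (Q.torusOrbit σ)) :
    ∃ (w : Fin n → ℤ) (v : Fin n → ℝ) (e : Module.Basis (Fin n) ℤ (Fin n → ℤ))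
      (_ : IsSmoothCorner P v e) (hw : IsSmoothCorner Q.toSet (latticeToReal w) e)
      (_ : ∀ i, latticeToReal (w + e i) ∈ Q.toSet), p.rep ⟨w, hw.mem⟩ ≠ 0 := by
  obtain ⟨m, hm, hpm⟩ := exists_extremePoint_of_mem_closure hp
  obtain ⟨w, v, e, hmw, hv, hw, hedge⟩ := exists_isSmoothCorner hP hQ hm
  have hmw' : m.1 = w := latticeToReal_injective hmw
  rw [hmw] at hw
  refine ⟨w, v, e, hv, hw, hedge, ?_⟩
  have hm' : (⟨w, hw.mem⟩ : Q.LatticePoint) = m := Subtype.ext hmw'.symm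
  rwa [hm']

theorem coord_eq_zero_of_notMem {w : Fin n → ℤ} {e : Module.Basis (Fin n) ℤ (Fin n → ℤ)}
    (hw : IsSmoothCorner Q.toSet (latticeToReal w) e)
    (hedge : ∀ i, latticeToReal (w + e i) ∈ Q.toSet) {p : ProjSpace Q.LatticePoint}
    {J : Finset (Fin n)} (hsupp : ∀ m : Q.LatticePoint, p.rep m ≠ 0 →
      latticeToReal m.1 ∈ cornerFace Q.toSet (latticeToReal w) e J) {i : Fin n} (hi : i ∉ J) :
    p.rep ⟨w + e i, hedge i⟩ = 0 := by
  by_contra h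
  exact hi ((edge_mem_cornerFace_iff hw i (hedge i) J).1 (hsupp _ h))

/-- The toric subvariety of a face consists of the points of the toric variety with support on
this face. -/
theorem mem_closure_torusOrbit_iff (hP : IsDelzant P) (hQ : normalFan Q.toSet = normalFan P)
    {f : Set (Fin n → ℝ)} (hf : f ∈ faces P) (p : ProjSpace Q.LatticePoint) :
    p ∈ closure (Q.torusOrbit (normalCone P f)) ↔
      p ∈ closure (Q.torusOrbit (normalCone P P)) ∧
        ∀ m : Q.LatticePoint, p.rep m ≠ 0 →
          latticeToReal m.1 ∈ Q.faceOfCone (normalCone P f) := by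
  constructor
  · intro hp
    obtain ⟨w, v, e, hv, hw, hedge, h0⟩ := exists_corner_of_mem_closure hP hQ hp
    refine ⟨?_, fun m hm => mem_faceOfCone_of_mem_closure hp hm⟩
    rw [hv.normalCone_self]
    exact mem_closure_torusOrbit hw (fun i hi => absurd (Finset.mem_univ i) hi)
      (hasCoords_chartVector hw hedge hp h0)
  · rintro ⟨hp, hsupp⟩
    obtain ⟨w, v, e, hv, hw, hedge, h0⟩ := exists_corner_of_mem_closure hP hQ hp
    obtain ⟨J, rfl⟩ := hv.exists_eq_cornerFace hf
      (vertex_mem_of_mem_faceOfCone hv hw hf (hsupp _ h0))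
    rw [hv.normalCone_cornerFace, faceOfCone_cornerCone hw] at hsupp
    rw [hv.normalCone_cornerFace]
    refine mem_closure_torusOrbit hw (fun i hi => ?_) (hasCoords_chartVector hw hedge hp h0)
    rw [coord_eq_zero_of_notMem hw hedge hsupp hi, zero_div]

end LatticePolytope

open Classical in
theorem sum_superset_neg_one_pow {n : ℕ} (I : Finset (Fin n)) :
    ∑ J ∈ Finset.univ.filter (fun J => I ⊆ J), (-1 : ℤ) ^ (n - J.card) =
      if I = Finset.univ then 1 else 0 := by
  have h : ∑ J ∈ Finset.univ.filter (fun J => I ⊆ J), (-1 : ℤ) ^ (n - J.card) =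
      ∑ K ∈ Iᶜ.powerset, (-1 : ℤ) ^ K.card := by
    refine Finset.sum_nbij' (fun J => Jᶜ) (fun K => Kᶜ) ?_ ?_ ?_ ?_ ?_
    · intro J hJ
      simpa using hJ
    · intro K hK
      rw [Finset.mem_powerset, Finset.subset_compl_comm] at hK
      simpa using hK
    · simp
    · simp
    · intro J _
      rw [Finset.card_compl, Fintype.card_fin]
  rw [h, Finset.sum_powerset_neg_one_pow_card]
  simp

namespace LatticePolytope

variable {n : ℕ} {P : Set (Fin n → ℝ)} {Q : LatticePolytope n}

open Classical in
/-- The Möbius-type cancellation: the faces that contain the support of a point with nonzero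
affine coordinates `I` at some corner correspond to the sets `J ⊇ I`, so the alternating sum over
them vanishes unless `I` is everything. -/
theorem sum_faces_neg_one_pow (hP : IsDelzant P) (hQ : normalFan Q.toSet = normalFan P)
    (hfin : (faces P).Finite) {p : ProjSpace Q.LatticePoint}
    (hp : p ∈ closure (Q.torusOrbit (normalCone P P))) :
    ∑ f ∈ hfin.toFinset.filter (fun f => ∀ m : Q.LatticePoint, p.rep m ≠ 0 →
        latticeToReal m.1 ∈ Q.faceOfCone (normalCone P f)), (-1 : ℤ) ^ (n - faceDim f) =
      if ∀ m, p.rep m ≠ 0 then 1 else 0 := by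
  obtain ⟨w, v, e, hv, hw, hedge, h0⟩ := exists_corner_of_mem_closure hP hQ hp
  obtain ⟨a, ha, hchart⟩ := p.hasCoords_rep.exists_smul (hasCoords_chartVector hw hedge hp h0)
  let I : Finset (Fin n) := Finset.univ.filter fun i => p.rep ⟨w + e i, hedge i⟩ ≠ 0
  have hI : ∀ i, i ∈ I ↔ p.rep ⟨w + e i, hedge i⟩ ≠ 0 := fun i => by simp [I]
  have hsupp : ∀ m : Q.LatticePoint, p.rep m ≠ 0 ↔
      latticeToReal m.1 ∈ cornerFace Q.toSet (latticeToReal w) e I := by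
    intro m
    rw [mem_cornerFace_iff_repr hw, hchart, Pi.smul_apply, smul_eq_mul,
      mul_ne_zero_iff_left ha, chartVector, Finset.prod_ne_zero_iff]
    refine forall_congr' fun i => ?_
    rw [hI, not_not, ne_eq, pow_eq_zero_iff', div_eq_zero_iff]
    simp only [Finset.mem_univ, true_imp_iff, h0, or_false]
    tauto
  have hfaces : hfin.toFinset.filter (fun f => ∀ m : Q.LatticePoint, p.rep m ≠ 0 →
        latticeToReal m.1 ∈ Q.faceOfCone (normalCone P f)) =
      (Finset.univ.filter fun J => I ⊆ J).image (cornerFace P v e) := by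
    ext f
    simp only [Finset.mem_filter, Set.Finite.mem_toFinset, Finset.mem_image, Finset.mem_univ,
      true_and]
    constructor
    · rintro ⟨hf, hm⟩
      obtain ⟨J, rfl⟩ := hv.exists_eq_cornerFace hf
        (vertex_mem_of_mem_faceOfCone hv hw hf (hm _ h0))
      refine ⟨J, fun i hi => ?_, rfl⟩
      by_contra hiJ
      rw [hv.normalCone_cornerFace, faceOfCone_cornerCone hw] at hm
      exact (hI i).1 hi (coord_eq_zero_of_notMem hw hedge hm hiJ)
    · rintro ⟨J, hIJ, rfl⟩
      refine ⟨hv.cornerFace_mem_faces J, fun m hm => ?_⟩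
      rw [hv.normalCone_cornerFace, faceOfCone_cornerCone hw]
      have := (hsupp m).1 hm
      exact ⟨this.1, fun i hi => this.2 i fun h => hi (hIJ h)⟩
  have hall : (∀ m, p.rep m ≠ 0) ↔ I = Finset.univ := by
    constructor
    · intro h
      exact Finset.eq_univ_of_forall fun i => (hI i).2 (h _)
    · intro h m
      rw [hsupp, h, IsSmoothCorner.cornerFace_univ]
      exact m.2
  rw [hfaces, Finset.sum_image hv.cornerFace_injective.injOn]
  simp only [hv.faceDim_cornerFace, hall]
  exact sum_superset_neg_one_pow I

/-- The points of the toric variety with nonzero coordinates form the big torus orbit. -/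
theorem mem_closure_and_forall_ne_zero_iff (hP : IsDelzant P)
    (hQ : normalFan Q.toSet = normalFan P) (p : ProjSpace Q.LatticePoint) :
    (p ∈ closure (Q.torusOrbit (normalCone P P)) ∧ ∀ m, p.rep m ≠ 0) ↔
      ∃ t : Fin n → ℂˣ, p.HasCoords fun m => ((∏ i, t i ^ m.1 i : ℂˣ) : ℂ) := by
  have hface : Q.faceOfCone (normalCone P P) = Q.toSet := by
    refine Set.Subset.antisymm (fun x hx => hx.1) fun x hx => ⟨hx, ?_⟩
    -- The linear forms of the normal cone along `P` are constant on `P`, hence zero, because `P` is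
    -- full-dimensional.
    obtain ⟨v, hv⟩ := hP.extremePoints_nonempty
    obtain ⟨e, he⟩ := hP.exists_isSmoothCorner hv
    intro u hu y _
    rw [he.normalCone_self] at hu
    rw [dual_eq_sum_latticeCoord e u x, dual_eq_sum_latticeCoord e u y]
    simp [hu.2]
  have hvec : ∀ t : Fin n → ℂˣ, Q.orbitVector (normalCone P P) t =
      fun m => ((∏ i, t i ^ m.1 i : ℂˣ) : ℂ) := fun t => by
    ext m
    rw [orbitVector, if_pos (by rw [hface]; exact m.2)]
  constructor
  · rintro ⟨hp, hne⟩
    obtain ⟨w, v, e, hv, hw, hedge, h0⟩ := exists_corner_of_mem_closure hP hQ hp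
    have hchart := hasCoords_chartVector hw hedge hp h0
    obtain ⟨t, a, ha, hta⟩ := exists_orbitVector_eq hw Finset.univ fun i =>
      Units.mk0 _ (div_ne_zero (hne ⟨w + e i, hedge i⟩) h0)
    rw [← hv.normalCone_self, hvec] at hta
    refine ⟨t, ?_⟩
    rw [hta]
    convert hchart.smul ha using 2
    ext m
    rw [if_pos (by rw [IsSmoothCorner.cornerFace_univ]; exact m.2)]
    rfl
  · rintro ⟨t, ht⟩
    refine ⟨subset_closure ⟨t, by rw [hvec]; exact ht⟩, fun m => ?_⟩
    obtain ⟨a, ha, hrep⟩ := p.hasCoords_rep.exists_smul ht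
    rw [hrep]
    exact mul_ne_zero ha (Units.ne_zero _)

end LatticePolytope

/-! ### Decomposition of classes by the support of the homogeneous coordinates -/

theorem ProjSpace.isOpen_ne_zero {ι : Type} (m : ι) : IsOpen {p : ProjSpace ι | p.rep m ≠ 0} := by
  have := ProjSpace.isOpen_basicOpen (MvPolynomial.isHomogeneous_X ℂ m)
  simpa [ProjSpace.basicOpen] using this

theorem ProjSpace.isLocallyClosed_eq_zero {ι : Type} (m : ι) :
    IsLocallyClosed {p : ProjSpace ι | p.rep m = 0} := by
  have := (ProjSpace.isOpen_ne_zero m).isClosed_compl.isLocallyClosed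
  simpa [Set.compl_ofPred] using this

open Classical in
/-- The class of a Zariski locally closed set in the Grothendieck ring (`0` for other sets). -/
noncomputable def classOf {ι : Type} [Finite ι] (Z : Set (ProjSpace ι)) : K0 :=
  if h : IsLocallyClosed Z then QPVariety.toK0 ⟨ι, Z, h⟩ else 0

section ClassOf

variable {ι : Type} [Finite ι]

theorem classOf_carrier (X : QPVariety) : classOf X.carrier = X.toK0 :=
  dif_pos X.isLocallyClosed

theorem classOf_eq_add {X Y : Set (ProjSpace ι)} (hX : IsLocallyClosed X) (hYX : Y ⊆ X)
    (hY : IsLocallyClosed Y) (hXY : IsLocallyClosed (X \ Y)) :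
    classOf X = classOf Y + classOf (X \ Y) := by
  rw [classOf, dif_pos hX, classOf, dif_pos hY, classOf, dif_pos hXY]
  have h := RingQuot.mkRingHom_rel (K0Rel.scissors ⟨ι, X, hX⟩ Y hYX hY hXY)
  rw [map_add] at h
  exact h

theorem classOf_empty : classOf (∅ : Set (ProjSpace ι)) = 0 := by
  have h : IsLocallyClosed (∅ : Set (ProjSpace ι)) := isOpen_empty.isLocallyClosed
  have := classOf_eq_add h subset_rfl h (by rwa [sdiff_self])
  rw [sdiff_self] at this
  exact left_eq_add.1 this

open Classical in
theorem classOf_eq_sum_powerset (s : Finset ι) {X : Set (ProjSpace ι)} (hX : IsLocallyClosed X) :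
    classOf X = ∑ T ∈ s.powerset, classOf {p ∈ X | ∀ m ∈ s, p.rep m ≠ 0 ↔ m ∈ T} := by
  induction s using Finset.induction_on generalizing X with
  | empty => simp
  | insert m s hm ih =>
    have h0 : IsLocallyClosed (X ∩ {p | p.rep m = 0}) :=
      hX.inter (ProjSpace.isLocallyClosed_eq_zero m)
    have hd : X \ (X ∩ {p | p.rep m = 0}) = X ∩ {p | p.rep m ≠ 0} := by
      ext p
      simp
    have h1 : IsLocallyClosed (X ∩ {p | p.rep m ≠ 0}) :=
      hX.inter (ProjSpace.isOpen_ne_zero m).isLocallyClosed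
    rw [classOf_eq_add hX Set.inter_subset_left h0 (hd ▸ h1), hd, ih h0, ih h1,
      Finset.sum_powerset_insert hm]
    congr 1 <;> refine Finset.sum_congr rfl fun T hT => ?_
    · have hmT : m ∉ T := fun h => hm (Finset.mem_powerset.1 hT h)
      congr 1
      ext p
      simp only [Set.mem_ofPred_eq, Set.mem_inter_iff, Finset.forall_mem_insert, hmT]
      tauto
    · congr 1
      ext p
      have : (∀ k ∈ s, p.rep k ≠ 0 ↔ k ∈ insert m T) ↔ ∀ k ∈ s, p.rep k ≠ 0 ↔ k ∈ T := by
        refine forall₂_congr fun k hk => ?_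
        rw [Finset.mem_insert, or_iff_right]
        rintro rfl
        exact hm hk
      simp only [Set.mem_ofPred_eq, Set.mem_inter_iff, Finset.forall_mem_insert, this]
      simp only [Finset.mem_insert_self, iff_true]
      tauto

/-- The class of a locally closed set is the sum of the classes of its strata of points with fixed
support. -/
theorem classOf_eq_sum_strata [Fintype ι] {X : Set (ProjSpace ι)} (hX : IsLocallyClosed X) :
    classOf X = ∑ T : Finset ι, classOf {p ∈ X | ∀ m, p.rep m ≠ 0 ↔ m ∈ T} := by
  classical
  rw [classOf_eq_sum_powerset Finset.univ hX, Finset.powerset_univ]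
  simp

end ClassOf

theorem QPVariety.toK0_eq_of_isomorphic {X Y : QPVariety} (h : X.Isomorphic Y) :
    X.toK0 = Y.toK0 :=
  RingQuot.mkRingHom_rel (K0Rel.iso X Y h)

/-! ### The big torus orbit is a torus -/

/-- A monomial map of degree zero between subsets of tori is regular. The sets are given by
parametrizations `Φ` and `Ψ` with which the monomial map is compatible. -/
theorem QPVariety.exists_isRegular_of_monomial {X Y : QPVariety} [Fintype X.index]
    [Nonempty Y.index] {τ : Type} (Φ : τ → X.index → ℂˣ) (Ψ : τ → Y.index → ℂˣ)
    (hX : ∀ p ∈ X.carrier, ∃ t, p.HasCoords fun i => (Φ t i : ℂ))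
    (hY : ∀ p t, p.HasCoords (fun k => (Ψ t k : ℂ)) → p ∈ Y.carrier)
    (a : Y.index → X.index → ℤ) (ha : ∀ k, ∑ i, a k i = 0)
    (hΦΨ : ∀ t k, ∏ i, Φ t i ^ a k i = Ψ t k) :
    ∃ f : X.carrier → Y.carrier, IsRegular X Y f ∧ ∀ (x : X.carrier) (t : τ),
      (x.1.HasCoords fun i => (Φ t i : ℂ)) → (f x).1.HasCoords fun k => (Ψ t k : ℂ) := by
  classical
  have := Fintype.ofFinite Y.index
  -- The monomials in the coordinates of a point are independent of the choices.
  have hrep : ∀ (x : ProjSpace X.index) (t : τ), (x.HasCoords fun i => (Φ t i : ℂ)) →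
      ∃ r : X.index → ℂˣ, (∀ i, x.rep i = r i) ∧ ∀ k, ∏ i, r i ^ a k i = Ψ t k := by
    intro x t hx
    obtain ⟨c, hc, h⟩ := x.hasCoords_rep.exists_smul hx
    refine ⟨fun i => Units.mk0 c hc * Φ t i, fun i => by rw [h]; simp, fun k => ?_⟩
    simp only [mul_zpow, Finset.prod_mul_distrib, hΦΨ]
    rw [← zpow_finset_sum, ha, zpow_zero, one_mul]
  have hΨ : ∀ (x : ProjSpace X.index) (t t' : τ), (x.HasCoords fun i => (Φ t i : ℂ)) →
      (x.HasCoords fun i => (Φ t' i : ℂ)) → Ψ t = Ψ t' := by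
    intro x t t' h h'
    obtain ⟨r, hr, hrt⟩ := hrep x t h
    obtain ⟨r', hr', hrt'⟩ := hrep x t' h'
    have : r = r' := funext fun i => Units.ext ((hr i).symm.trans (hr' i))
    subst this
    exact funext fun k => (hrt k).symm.trans (hrt' k)
  have hex : ∀ x : X.carrier, ∃ y : Y.carrier, ∀ t, (x.1.HasCoords fun i => (Φ t i : ℂ)) →
      y.1.HasCoords fun k => (Ψ t k : ℂ) := by
    intro x
    obtain ⟨t, ht⟩ := hX x.1 x.2
    obtain ⟨q, hq⟩ := ProjSpace.exists_hasCoords (v := fun k => (Ψ t k : ℂ))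
      (Function.ne_iff.2 ⟨Classical.arbitrary _, Units.ne_zero _⟩)
    exact ⟨⟨q, hY q t hq⟩, fun t' ht' => hΨ x.1 t t' ht ht' ▸ hq⟩
  choose f hf using hex
  refine ⟨f, fun x => ⟨Set.univ, isOpen_univ, trivial, ?_⟩, hf⟩
  -- Multiplication with a power of the product of all coordinates makes the exponents nonnegative.
  obtain ⟨N, hN⟩ : ∃ N : ℕ, ∀ k i, 0 ≤ a k i + N := by
    refine ⟨∑ k, ∑ i, (a k i).natAbs, fun k i => ?_⟩
    have h1 : (a k i).natAbs ≤ ∑ i, (a k i).natAbs :=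
      Finset.single_le_sum (f := fun i => (a k i).natAbs) (fun _ _ => Nat.zero_le _)
        (Finset.mem_univ i)
    have h2 : ∑ i, (a k i).natAbs ≤ ∑ k, ∑ i, (a k i).natAbs :=
      Finset.single_le_sum (f := fun k => ∑ i, (a k i).natAbs) (fun _ _ => Nat.zero_le _)
        (Finset.mem_univ k)
    have h3 := h1.trans h2
    omega
  refine ⟨Fintype.card X.index * N, fun k => ∏ i, MvPolynomial.X i ^ (a k i + N).toNat,
    fun k => ?_, fun x' _ => ?_⟩
  · have hdeg : Fintype.card X.index * N = ∑ i, (a k i + N).toNat := by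
      zify
      simp only [Int.toNat_of_nonneg (hN k _), Finset.sum_add_distrib, ha]
      simp
    rw [hdeg]
    exact MvPolynomial.IsHomogeneous.prod _ _ _ fun i _ => by
      simpa using (MvPolynomial.isHomogeneous_X ℂ i).pow (a k i + N).toNat
  · obtain ⟨t, ht⟩ := hX x'.1 x'.2
    obtain ⟨r, hr, hrt⟩ := hrep x'.1 t ht
    convert (hf x' t ht).smul (Units.ne_zero (∏ i, r i ^ N)) using 1
    ext k
    have : ∏ i, r i ^ (a k i + N).toNat = (∏ i, r i ^ N) * Ψ t k := by
      rw [← hrt, ← Finset.prod_mul_distrib]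
      refine Finset.prod_congr rfl fun i _ => ?_
      rw [← zpow_natCast, Int.toNat_of_nonneg (hN k i), zpow_add, zpow_natCast, mul_comm]
    rw [Pi.smul_apply, smul_eq_mul, ← Units.val_mul, ← this]
    simp [hr]

namespace LatticePolytope

variable {n : ℕ} {P : Set (Fin n → ℝ)} {Q : LatticePolytope n}

/-- A variety in the projective space of the lattice points of `Q` that consists of the
points `[tᵐ]` is isomorphic to the torus. -/
theorem isomorphic_torus (hP : IsDelzant P) (hQ : normalFan Q.toSet = normalFan P)
    {Z : Set (ProjSpace Q.LatticePoint)} (hZ : IsLocallyClosed Z)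
    (hmem : ∀ p, p ∈ Z ↔
      ∃ t : Fin n → ℂˣ, p.HasCoords fun m => ((∏ i, t i ^ m.1 i : ℂˣ) : ℂ)) :
    QPVariety.Isomorphic ⟨Q.LatticePoint, Z, hZ⟩ (QPVariety.torus n) := by
  classical
  have : Fintype Q.LatticePoint := Fintype.ofFinite _
  obtain ⟨s, hs⟩ := Q.nonempty
  have : Nonempty Q.LatticePoint := ⟨⟨s, subset_convexHull ℝ _ ⟨s, hs, rfl⟩⟩⟩
  have hQfin : (latticeToReal '' (Q.generators : Set (Fin n → ℤ))).Finite :=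
    Q.generators.finite_toSet.image _
  obtain ⟨w', hw'⟩ := (hQfin.isCompact_convexHull (𝕜 := ℝ)).extremePoints_nonempty
    ⟨_, subset_convexHull ℝ _ ⟨s, hs, rfl⟩⟩
  obtain ⟨w, v, e, rfl, -, hw, hedge⟩ := exists_isSmoothCorner hP hQ hw'
  let W : Q.LatticePoint := ⟨w, hw.mem⟩
  let E : Fin n → Q.LatticePoint := fun i => ⟨w + e i, hedge i⟩
  let Φ : (Fin n → ℂˣ) → Q.LatticePoint → ℂˣ := fun t m => ∏ i, t i ^ m.1 i
  let Ψ : (Fin n → ℂˣ) → Fin (n + 1) → ℂˣ := fun t => Fin.cons 1 t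
  -- `t j` is the character of the standard basis vector, an integral combination of the edges.
  let a : Fin (n + 1) → Q.LatticePoint → ℤ := Fin.cons 0 fun j => ∑ i,
    e.repr (Pi.single j 1) i • (Pi.single (E i) 1 - Pi.single W 1)
  let b : Q.LatticePoint → Fin (n + 1) → ℤ := fun m => Fin.cons (-∑ i, m.1 i) m.1
  have hmemT : ∀ p : ProjSpace (Fin (n + 1)), p ∈ (QPVariety.torus n).carrier ↔
      ∃ t, p.HasCoords fun k => (Ψ t k : ℂ) := by
    intro p
    constructor
    · intro hp
      refine ⟨fun j => Units.mk0 _ (hp j.succ) / Units.mk0 _ (hp 0), ?_⟩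
      convert p.hasCoords_rep.smul (inv_ne_zero (hp 0)) using 1
      ext k
      refine Fin.cases ?_ (fun j => ?_) k
      · simp [Ψ, inv_mul_cancel₀ (hp 0)]
      · simp [Ψ, div_eq_inv_mul]
    · rintro ⟨t, ht⟩ k
      obtain ⟨c, hc, h⟩ := p.hasCoords_rep.exists_smul ht
      rw [h]
      exact mul_ne_zero hc (Units.ne_zero _)
  have hab : ∀ t k, ∏ m, Φ t m ^ a k m = Ψ t k := by
    intro t k
    refine Fin.cases ?_ (fun j => ?_) k
    · simp [a, Ψ]
    · have h1 : ∀ M : Q.LatticePoint, ∏ m, Φ t m ^ (Pi.single M 1 : Q.LatticePoint → ℤ) m =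
          Φ t M := fun M => by
        rw [Finset.prod_eq_single M (fun m _ hm => by rw [Pi.single_eq_of_ne hm, zpow_zero])
          (by simp), Pi.single_eq_same, zpow_one]
      have h2 : ∀ i, Φ t (E i) * (Φ t W)⁻¹ = ∏ k, t k ^ e i k := fun i => by
        have : Φ t (E i) = Φ t W * ∏ k, t k ^ e i k := prod_zpow_add t w (e i)
        rw [this, mul_inv_cancel_comm]
      have h3 : ∀ k, ∑ i, e.repr (Pi.single j 1) i * e i k = (Pi.single j 1 : Fin n → ℤ) k := by
        intro k
        have := congrFun (e.sum_repr (Pi.single j 1)) k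
        simpa only [Finset.sum_apply, Pi.smul_apply, smul_eq_mul] using this
      calc ∏ m, Φ t m ^ a j.succ m
          = ∏ m, ∏ i, (Φ t m ^ (Pi.single (E i) 1 : Q.LatticePoint → ℤ) m *
              (Φ t m ^ (Pi.single W 1 : Q.LatticePoint → ℤ) m)⁻¹) ^ e.repr (Pi.single j 1) i := by
            refine Finset.prod_congr rfl fun m _ => ?_
            simp only [a, Fin.cons_succ, Finset.sum_apply, zpow_finset_sum]
            refine Finset.prod_congr rfl fun i _ => ?_
            rw [Pi.smul_apply, Pi.sub_apply, smul_eq_mul, mul_comm, zpow_mul, zpow_sub]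
        _ = ∏ i, (∏ k, t k ^ e i k) ^ e.repr (Pi.single j 1) i := by
            rw [Finset.prod_comm]
            refine Finset.prod_congr rfl fun i _ => ?_
            rw [Finset.prod_zpow, Finset.prod_mul_distrib, Finset.prod_inv_distrib, h1, h1, h2]
        _ = ∏ k, t k ^ (Pi.single j 1 : Fin n → ℤ) k := by
            simp only [← Finset.prod_zpow, ← zpow_mul]
            rw [Finset.prod_comm]
            refine Finset.prod_congr rfl fun k _ => ?_
            rw [← zpow_finset_sum, ← h3]
            simp only [mul_comm]
        _ = Ψ t j.succ := by
            rw [Finset.prod_eq_single j (fun k _ hk => by rw [Pi.single_eq_of_ne hk, zpow_zero])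
              (by simp), Pi.single_eq_same, zpow_one]
            rfl
  have hba : ∀ t m, ∏ k, Ψ t k ^ b m k = Φ t m := by
    intro t m
    rw [Fin.prod_univ_succ]
    simp [Ψ, b, Φ]
  have ha0 : ∀ k, ∑ m, a k m = 0 := by
    intro k
    refine Fin.cases ?_ (fun j => ?_) k
    · simp [a]
    · simp only [a, Fin.cons_succ, Finset.sum_apply]
      rw [Finset.sum_comm]
      refine Finset.sum_eq_zero fun i _ => ?_
      simp only [Pi.smul_apply, Pi.sub_apply, ← Finset.smul_sum, Finset.sum_sub_distrib]
      simp
  have hb0 : ∀ m, ∑ k, b m k = 0 := by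
    intro m
    rw [Fin.sum_univ_succ]
    simp [b]
  have : Nonempty (QPVariety.torus n).index := ⟨(0 : Fin (n + 1))⟩
  let : Fintype (QPVariety.torus n).index := Fin.fintype (n + 1)
  obtain ⟨f, hf, hfc⟩ := QPVariety.exists_isRegular_of_monomial
    (X := ⟨Q.LatticePoint, Z, hZ⟩) (Y := QPVariety.torus n) Φ Ψ (fun p hp => (hmem p).1 hp)
    (fun p t ht => (hmemT p).2 ⟨t, ht⟩) a ha0 hab
  obtain ⟨g, hg, hgc⟩ := QPVariety.exists_isRegular_of_monomial
    (X := QPVariety.torus n) (Y := ⟨Q.LatticePoint, Z, hZ⟩) Ψ Φ (fun p hp => (hmemT p).1 hp)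
    (fun p t ht => (hmem p).2 ⟨t, ht⟩) b hb0 hba
  refine ⟨⟨f, g, fun x => ?_, fun y => ?_⟩, hf, hg⟩
  · obtain ⟨t, ht⟩ := (hmem x.1).1 x.2
    exact Subtype.ext ((hgc _ t (hfc x t ht)).unique ht)
  · obtain ⟨t, ht⟩ := (hmemT y.1).1 y.2
    exact Subtype.ext ((hfc _ t (hgc y t ht)).unique ht)

end LatticePolytope

/-! ### The motivic interior of the toric variety -/

theorem proposition5p1 (n : ℕ) (P : Set (Fin n → ℝ)) (hP : IsDelzant P) :
    (faces P).Finite ∧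
    (∃ Q : LatticePolytope n, normalFan Q.toSet = normalFan P) ∧
    ∀ Q : LatticePolytope n, normalFan Q.toSet = normalFan P →
      ∑ᶠ f ∈ faces P,
          (-1 : K0) ^ (n - faceDim f) * (Q.toricSubvariety (normalCone P f)).toK0 =
        (QPVariety.torus n).toK0 := by
  classical
  have hfin : (faces P).Finite := by
    obtain ⟨S, -, rfl⟩ := hP.polytope
    exact finite_faces S.finite_toSet
  refine ⟨hfin, hP.exists_latticePolytope, fun Q hQ => ?_⟩
  have : Fintype Q.LatticePoint := Fintype.ofFinite _
  set X : Set (ProjSpace Q.LatticePoint) := closure (Q.torusOrbit (normalCone P P))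
  have hX : IsLocallyClosed X := isClosed_closure.isLocallyClosed
  let stratum : Finset Q.LatticePoint → Set (ProjSpace Q.LatticePoint) := fun T =>
    {p ∈ X | ∀ m, p.rep m ≠ 0 ↔ m ∈ T}
  let liesOn : Finset Q.LatticePoint → Set (Fin n → ℝ) → Prop := fun T f =>
    ∀ m ∈ T, latticeToReal m.1 ∈ Q.faceOfCone (normalCone P f)
  have hY : ∀ f ∈ faces P, (Q.toricSubvariety (normalCone P f)).toK0 =
      ∑ T : Finset Q.LatticePoint, if liesOn T f then classOf (stratum T) else 0 := by
    intro f hf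
    rw [← classOf_carrier]
    refine (classOf_eq_sum_strata (ι := Q.LatticePoint)
      (Q.toricSubvariety (normalCone P f)).isLocallyClosed).trans ?_
    refine Finset.sum_congr rfl fun T _ => ?_
    have hmem : ∀ p : ProjSpace Q.LatticePoint,
        p ∈ (Q.toricSubvariety (normalCone P f)).carrier ∧ (∀ m, p.rep m ≠ 0 ↔ m ∈ T) ↔
          p ∈ stratum T ∧ liesOn T f := by
      intro p
      change (p ∈ closure (Q.torusOrbit (normalCone P f)) ∧ _) ↔ (p ∈ X ∧ _) ∧ _
      rw [LatticePolytope.mem_closure_torusOrbit_iff hP hQ hf, and_assoc, and_assoc]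
      refine and_congr_right fun _ => ?_
      rw [and_comm]
      refine and_congr_right fun hT => ?_
      simp only [hT, liesOn]
    split_ifs with h
    · congr 1
      ext p
      exact (hmem p).trans (and_iff_left h)
    · exact (congrArg classOf (Set.eq_empty_iff_forall_notMem.2 fun p hp =>
        h ((hmem p).1 hp).2)).trans classOf_empty
  rw [finsum_mem_eq_finite_toFinset_sum _ hfin]
  have hcoeff : ∀ T : Finset Q.LatticePoint,
      (∑ f ∈ hfin.toFinset, if liesOn T f then (-1 : K0) ^ (n - faceDim f) else 0) *
        classOf (stratum T) = if T = Finset.univ then classOf (stratum T) else 0 := by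
    intro T
    rcases (stratum T).eq_empty_or_nonempty with h | ⟨p, hpX, hpT⟩
    · rw [h, classOf_empty, mul_zero, ite_self]
    · have key := congrArg (Int.cast : ℤ → K0)
        (LatticePolytope.sum_faces_neg_one_pow hP hQ hfin hpX)
      simp only [hpT] at key
      rw [Finset.sum_filter] at key
      push_cast at key
      rw [key]
      by_cases hT : T = Finset.univ
      · rw [if_pos hT, if_pos (by simp [hT]), one_mul]
      · rw [if_neg hT, if_neg (fun h => hT (Finset.eq_univ_of_forall h)), zero_mul]
  have hmemU : ∀ p, p ∈ stratum Finset.univ ↔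
      ∃ t : Fin n → ℂˣ, p.HasCoords fun m => ((∏ i, t i ^ m.1 i : ℂˣ) : ℂ) := by
    intro p
    rw [← LatticePolytope.mem_closure_and_forall_ne_zero_iff hP hQ]
    simp [stratum, X]
  have hU : IsLocallyClosed (stratum Finset.univ) := by
    have : stratum Finset.univ = X ∩ ⋂ m, {p | p.rep m ≠ 0} := by
      ext p
      simp [stratum]
    rw [this]
    exact hX.inter (isOpen_iInter_of_finite ProjSpace.isOpen_ne_zero).isLocallyClosed
  calc ∑ f ∈ hfin.toFinset,
        (-1 : K0) ^ (n - faceDim f) * (Q.toricSubvariety (normalCone P f)).toK0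
      = ∑ f ∈ hfin.toFinset, ∑ T : Finset Q.LatticePoint,
          (if liesOn T f then (-1 : K0) ^ (n - faceDim f) else 0) * classOf (stratum T) := by
        refine Finset.sum_congr rfl fun f hf => ?_
        rw [hY f (hfin.mem_toFinset.1 hf), Finset.mul_sum]
        refine Finset.sum_congr rfl fun T _ => ?_
        split_ifs <;> simp
    _ = ∑ T : Finset Q.LatticePoint, if T = Finset.univ then classOf (stratum T) else 0 := by
        rw [Finset.sum_comm]
        refine Finset.sum_congr rfl fun T _ => ?_
        rw [← Finset.sum_mul, hcoeff]
    _ = classOf (stratum Finset.univ) := by simp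
    _ = (QPVariety.torus n).toK0 := by
        rw [classOf, dif_pos hU]
        exact QPVariety.toK0_eq_of_isomorphic (LatticePolytope.isomorphic_torus hP hQ hU hmemU)
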